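/- Let $\Omega\subset\mathbb R^2$ be a bounded polygonal domain, that is, a bounded connected open set which near each of its boundary points is a circular sector of opening angle strictly between $0$ and $2\pi$; assume that $\Omega$ is simply connected. Let a staggered pair of finite polygonal meshes of $\overline\Omega$ be given, with the following properties and notation. * The dual cells $A_\nu$ are closed regions enclosed by simple polygons; they have disjoint interiors and cover $\overline\Omega$. The primary cells $A_i$ (the parts in $\overline\Omega$, for cells at the boundary) are also such regions, with disjoint interiors, and also cover $\overline\Omega$. The centers $x_i$ of the primary cells are the vertices of the dual cells, and the centers $x_\nu$ of the dual cells, with $x_\nu$ in the interior of $A_\nu$, are the vertices of the primary cells lying in $\Omega$. If a primary cell meets $\partial\Omega$, its center lies on $\partial\Omega$, and the other primary centers lie in the interiors of their cells. * Primary and dual edges come in pairs indexed by $e$. The dual edge $e$ is the segment joining the centers of the two primary cells $i\in \mathrm{CE}(e)$; $d_e$ is its length. If it is not contained in $\partial\Omega$, then two dual cells $\nu\in\mathrm{VE}(e)$ border it and the primary edge $e$ is the segment joining their centers. If it is contained in $\partial\Omega$, then $\mathrm{VE}(e)$ has a single element $\nu$ and the primary edge $e$ runs from $x_\nu$ to a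 point of the dual edge. The two edges of a pair are orthogonal and meet at a point $y_e$ which is an endpoint of neither, except that $y_e$ is the boundary endpoint of the primary edge if $e$ is on the boundary. Distinct edges of the same mesh meet only in common vertices (the $x_i$ for dual edges, the $x_\nu$ for primary edges), and a primary edge meets no dual edge other than its partner. The sides of $A_\nu$ are the dual edges $e\in\mathrm{EV}(\nu)=\{e:\nu\in \mathrm{VE}(e)\}$. The sides of $A_i$ are the primary edges $e$ with $i\in\mathrm{CE}(e)$ and, at the boundary, the segments $[x_i,y_e]$ of the boundary edges $e$ with $i\in \mathrm{CE}(e)$. The diamonds $A_e$, the convex hulls of $\{x_i: i\in\mathrm{CE}(e)\}\cup\{x_\nu:\nu\in \mathrm{VE}(e)\}$, have disjoint interiors. * For each $e$, $\mathbf n_e$ is a unit normal to the primary edge $e$ (in either direction), and $\mathbf t_e$ is $\mathbf n_e$ rotated counterclockwise by a right angle. For $i\in\mathrm{CE}(e)$, $n_{e,i}=1$ if $\mathbf n_e$ points away from $A_i$, i.e. $\mathbf n_e\cdot(y_e-x_i)>0$, and $n_{e,i}=-1$ otherwise. For $\nu\in\mathrm{VE}(e)$, $t_{e,\nu}=1$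 if $\mathbf t_e$ points away from $A_\nu$, i.e. $\mathbf t_e\cdot(y_e-x_\nu)>0$, and $t_{e,\nu}=-1$ otherwise. With $\chi_i,\chi_\nu,\chi_e$ the characteristic functions of (the interiors of) $A_i,A_\nu,A_e$, let $\Phi_h$, $\Psi_h$ and $V_h$ be the spaces of all fields $\varphi_h=\sum_i\varphi_i\chi_i$, $\psi_h=\sum_\nu\psi_\nu\chi_\nu$ and $u_h=\sum_e u_e\chi_e\mathbf n_e$ with real coefficients. Define $\nabla_h:\Phi_h\to V_h$ and $\widetilde\nabla_h\times:V_h\to\Psi_h$ by $$[\nabla_h\varphi_h]_e=\frac{-1}{d_e}\sum_{i\in\mathrm{CE}(e)}\varphi_i\,n_{e,i},\qquad [\widetilde\nabla_h\times u_h]_\nu=\frac{-1}{|A_\nu|}\sum_{e\in\mathrm{EV}(\nu)}u_e\,d_e\,t_{e,\nu}.$$ Then for every $u_h\in V_h$, $$\widetilde\nabla_h\times u_h=0\iff\text{there exists }\varphi_h\in\Phi_h\text{ such that }u_h=\nabla_h\varphi_h .$$ -/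

import Mathlib

open Set

noncomputable section

namespace StaggeredGrid

/-- The Euclidean plane. -/
abbrev Plane : Type := EuclideanSpace ℝ (Fin 2)

/-- Rotation by a right angle, `v ↦ k × v` with `k` the upward unit vector. -/
def rot (v : Plane) : Plane := !₂[-(v 1), v 0]

/-- The open circular sector with vertex `x`, radius `r` and directions strictly between the
angles `α` and `β`. -/
def sector (x : Plane) (r α β : ℝ) : Set Plane :=
  {p | ∃ ρ θ : ℝ, 0 < ρ ∧ ρ < r ∧ α < θ ∧ θ < β ∧ p = x + ρ • !₂[Real.cos θ, Real.sin θ]}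

/-- A bounded polygonal domain: a bounded, connected, open set which near each of its boundary
points is a circular sector of opening angle strictly between `0` and `2π` (the angle is `π` at
the points in the middle of a side, and different from `π` at the corners). -/
structure IsPolygonalDomain (Ω : Set Plane) : Prop where
  isOpen : IsOpen Ω
  isBounded : Bornology.IsBounded Ω
  isConnected : IsConnected Ω
  locally_sector : ∀ x ∈ frontier Ω, ∃ r α β : ℝ, 0 < r ∧ α < β ∧ β < α + 2 * Real.pi ∧
    Ω ∩ Metric.ball x r = sector x r α β

/-- `P` is the closed region enclosed by the simple closed polygon with the cyclically ordered
vertices `v 0, v 1, …, v (n - 1)`.  The region need not be convex, and straight angles are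
allowed. -/
structure IsPolygon (P : Set Plane) (n : ℕ) (v : ZMod n → Plane) : Prop where
  three_le : 3 ≤ n
  injective : Function.Injective v
  sides_inter : ∀ j k, j ≠ k → segment ℝ (v j) (v (j + 1)) ∩ segment ℝ (v k) (v (k + 1)) ⊆
    {v j, v (j + 1)} ∩ {v k, v (k + 1)}
  isCompact : IsCompact P
  closure_interior : closure (interior P) = P
  interior_connected : IsConnected (interior P)
  frontier_eq : frontier P = ⋃ k, segment ℝ (v k) (v (k + 1))

/-- The geometric data of a staggered pair of meshes.  The type `I` indexes the primary cells
(= vertices of the dual mesh), `N` the dual cells (= vertices of the primary mesh) and `E` the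
edge pairs. -/
structure MeshData (I N E : Type*) where
  /-- centre `x_i` of the primary cell `i` -/
  primaryCenter : I → Plane
  /-- centre `x_ν` of the dual cell `ν` -/
  dualCenter : N → Plane
  /-- primary cell `A_i`; for cells at the boundary, the part contained in the closed domain -/
  primaryCell : I → Set Plane
  /-- dual cell `A_ν` -/
  dualCell : N → Set Plane
  /-- the primary cells bordering edge `e` -/
  CE : E → Finset I
  /-- the dual cells bordering edge `e` -/
  VE : E → Finset N
  /-- the intersection point of the primary and the dual edge of the pair `e` -/
  crossing : E → Plane
  /-- the unit normal `n_e` of the primary edge -/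
  normal : E → Plane

namespace MeshData

variable {I N E : Type*} (T : MeshData I N E)

/-- The dual cell edge of the pair `e`, joining the centres of its two primary cells. -/
def dualEdge (e : E) : Set Plane := convexHull ℝ (T.primaryCenter '' T.CE e)

/-- The primary cell edge of the pair `e`.  For an interior pair it joins the two dual centres
(the crossing point lies on it); for a boundary pair it joins the only dual centre to the
boundary. -/
def primaryEdge (e : E) : Set Plane :=
  convexHull ℝ (insert (T.crossing e) (T.dualCenter '' T.VE e))

/-- The diamond `A_e`, with the two edges of the pair as diagonals (a triangle if `e` is on the
boundary). -/
def diamond (e : E) : Set Plane :=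
  convexHull ℝ (T.primaryCenter '' T.CE e ∪ T.dualCenter '' T.VE e)

/-- The length `d_e` of the dual edge (the distance of the two primary centres). -/
def dualLength (e : E) : ℝ := Metric.diam (T.dualEdge e)

/-- The tangent `t_e = k × n_e` of the primary edge. -/
def tangent (e : E) : Plane := rot (T.normal e)

/-- `n_{e,i}`: `1` if `n_e` points away from the primary cell `i`, and `-1` if it points towards
it. -/
def nSign (e : E) (i : I) : ℝ :=
  if 0 < inner ℝ (T.normal e) (T.crossing e - T.primaryCenter i) then 1 else -1

/-- `t_{e,ν}`: `1` if `t_e` points away from the dual cell `ν`, and `-1` if it points towards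
it. -/
def tSign (e : E) (ν : N) : ℝ :=
  if 0 < inner ℝ (T.tangent e) (T.crossing e - T.dualCenter ν) then 1 else -1

open Classical in
/-- `EV(ν)`: the edges that form the boundary of the dual cell `ν`. -/
def EV [Fintype E] (ν : N) : Finset E := {e | ν ∈ T.VE e}

end MeshData

/-- A staggered pair of polygonal meshes on `Ω`. -/
structure StaggeredMesh (Ω : Set Plane) (I N E : Type*) extends MeshData I N E where
  primaryCenter_injective : Function.Injective primaryCenter
  dualCenter_injective : Function.Injective dualCenter
  card_CE : ∀ e, (CE e).card = 2
  /-- a dual edge borders one dual cell if it is aligned with the boundary, and two otherwise -/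
  card_VE_boundary : ∀ e, toMeshData.dualEdge e ⊆ frontier Ω → (VE e).card = 1
  card_VE_interior : ∀ e, ¬ toMeshData.dualEdge e ⊆ frontier Ω → (VE e).card = 2
  /-- the two edges of a pair cross inside each other … -/
  crossing_mem_dual : ∀ e, crossing e ∈ toMeshData.dualEdge e
  crossing_ne_primaryCenter : ∀ e, ∀ i ∈ CE e, crossing e ≠ primaryCenter i
  crossing_mem_primary : ∀ e, ¬ toMeshData.dualEdge e ⊆ frontier Ω →
    crossing e ∈ convexHull ℝ (dualCenter '' VE e)
  crossing_ne_dualCenter : ∀ e, ∀ ν ∈ VE e, crossing e ≠ dualCenter ν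
  /-- … orthogonally -/
  orthogonal : ∀ e, ∀ i ∈ CE e, ∀ ν ∈ VE e,
    inner ℝ (primaryCenter i - crossing e) (dualCenter ν - crossing e) = 0
  norm_normal : ∀ e, ‖normal e‖ = 1
  normal_orthogonal : ∀ e, ∀ ν ∈ VE e, inner ℝ (normal e) (dualCenter ν - crossing e) = 0
  /-- distinct edges of the same mesh meet in common vertices only, and a primary edge meets no
  dual edge but its partner -/
  dualEdge_inter : ∀ e f, e ≠ f → toMeshData.dualEdge e ∩ toMeshData.dualEdge f ⊆
    primaryCenter '' (CE e ∩ CE f : Set I)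
  primaryEdge_inter : ∀ e f, e ≠ f → toMeshData.primaryEdge e ∩ toMeshData.primaryEdge f ⊆
    dualCenter '' (VE e ∩ VE f : Set N)
  primaryEdge_dualEdge : ∀ e f, e ≠ f →
    Disjoint (toMeshData.primaryEdge e) (toMeshData.dualEdge f)
  /-- the dual cells are polygons; their vertices are primary centres and their sides are the
  dual edges that border them -/
  dualCell_polygon : ∀ ν, ∃ (n : ℕ) (c : ZMod n → I),
    IsPolygon (dualCell ν) n (fun k => primaryCenter (c k)) ∧
    {s : Set I | ∃ e, ν ∈ VE e ∧ s = CE e} = range fun k => {c k, c (k + 1)}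
  /-- the primary cells are polygons; their sides are the primary edges that border them and, for
  the cells at the boundary, the adjacent halves of the dual edges in the boundary -/
  primaryCell_polygon : ∀ i, ∃ (n : ℕ) (v : ZMod n → Plane), IsPolygon (primaryCell i) n v ∧
    (range fun k => segment ℝ (v k) (v (k + 1))) =
      {s | ∃ e, i ∈ CE e ∧ s = toMeshData.primaryEdge e} ∪
      {s | ∃ e, i ∈ CE e ∧ toMeshData.dualEdge e ⊆ frontier Ω ∧
        s = segment ℝ (primaryCenter i) (crossing e)}
  /-- centres lie in their cells; those of the primary cells at the boundary lie on it -/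
  dualCenter_mem : ∀ ν, dualCenter ν ∈ interior (dualCell ν)
  primaryCenter_mem : ∀ i, primaryCenter i ∈ primaryCell i
  primaryCenter_interior : ∀ i, primaryCenter i ∈ Ω → primaryCenter i ∈ interior (primaryCell i)
  primaryCenter_boundary : ∀ i, (primaryCell i ∩ frontier Ω).Nonempty →
    primaryCenter i ∈ frontier Ω
  /-- each family of cells covers the closed domain, and no family has overlapping members -/
  dualCell_cover : ⋃ ν, dualCell ν = closure Ω
  primaryCell_cover : ⋃ i, primaryCell i = closure Ω
  dualCell_disjoint : ∀ ν μ, ν ≠ μ → Disjoint (interior (dualCell ν)) (interior (dualCell μ))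
  primaryCell_disjoint : ∀ i j, i ≠ j →
    Disjoint (interior (primaryCell i)) (interior (primaryCell j))
  diamond_disjoint : ∀ e f, e ≠ f →
    Disjoint (interior (toMeshData.diamond e)) (interior (toMeshData.diamond f))

/-- The piecewise constant field `∑ k, c k χ_k w_k`, where `χ_k` is the characteristic function of
the cell `S k`.  Cells are taken open here, so that distinct cells do not share boundary points;
this affects values on edges only. -/
def cellField {ι F : Type*} [Fintype ι] [AddCommGroup F] [Module ℝ F] (S : ι → Set Plane)
    (w : ι → F) : (ι → ℝ) →ₗ[ℝ] (Plane → F) where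
  toFun c x := ∑ k, c k • (interior (S k)).indicator (fun _ => w k) x
  map_add' c d := by
    funext x
    simp [add_smul, Finset.sum_add_distrib]
  map_smul' a c := by
    funext x
    simp [mul_smul, Finset.smul_sum]

theorem cellField_injective {ι F : Type*} [Fintype ι] [AddCommGroup F] [Module ℝ F]
    (S : ι → Set Plane) (w : ι → F)
    (hw : ∀ k, w k ≠ 0) (hS : ∀ k, (interior (S k)).Nonempty)
    (hd : ∀ j k, j ≠ k → Disjoint (interior (S j)) (interior (S k))) :
    Function.Injective (cellField S w) := by
  rw [injective_iff_map_eq_zero]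
  intro c hc
  funext k
  obtain ⟨x, hx⟩ := hS k
  have h := congrFun hc x
  have h2 : (cellField S w) c x = c k • w k := by
    change ∑ j, c j • (interior (S j)).indicator (fun _ => w j) x = _
    rw [Finset.sum_eq_single k]
    · rw [indicator_of_mem hx]
    · intro j _ hj
      rw [indicator_of_notMem, smul_zero]
      exact fun hxj => Set.disjoint_left.1 (hd j k hj) hxj hx
    · simp
  rw [h2] at h
  exact (smul_eq_zero.1 h).resolve_right (hw k)

namespace StaggeredMesh

variable {Ω : Set Plane} {I N E : Type*} (M : StaggeredMesh Ω I N E)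

theorem interior_dualCell_nonempty (ν : N) : (interior (M.dualCell ν)).Nonempty :=
  ⟨_, M.dualCenter_mem ν⟩

theorem interior_primaryCell_nonempty (i : I) : (interior (M.primaryCell i)).Nonempty := by
  obtain ⟨n, v, hv, -⟩ := M.primaryCell_polygon i
  exact hv.interior_connected.nonempty

theorem normal_ne_zero (e : E) : M.normal e ≠ 0 := by
  intro h
  have := M.norm_normal e
  simp [h] at this

theorem interior_diamond_nonempty (e : E) : (interior (M.diamond e)).Nonempty := by
  obtain ⟨i, hi⟩ : (M.CE e).Nonempty := by
    rw [← Finset.card_pos, M.card_CE e]; norm_num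
  obtain ⟨ν, hν⟩ : (M.VE e).Nonempty := by
    rw [← Finset.card_pos]
    by_cases h : M.dualEdge e ⊆ frontier Ω
    · rw [M.card_VE_boundary e h]; norm_num
    · rw [M.card_VE_interior e h]; norm_num
  set S : Set Plane := M.primaryCenter '' M.CE e ∪ M.dualCenter '' M.VE e with hS
  have hy : M.crossing e ∈ affineSpan ℝ S :=
    convexHull_subset_affineSpan S (convexHull_mono subset_union_left (M.crossing_mem_dual e))
  have hx : M.primaryCenter i ∈ affineSpan ℝ S :=
    subset_affineSpan ℝ S (Or.inl ⟨i, hi, rfl⟩)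
  have hz : M.dualCenter ν ∈ affineSpan ℝ S :=
    subset_affineSpan ℝ S (Or.inr ⟨ν, hν, rfl⟩)
  have hli : LinearIndependent ℝ
      ![M.primaryCenter i - M.crossing e, M.dualCenter ν - M.crossing e] := by
    refine linearIndependent_of_ne_zero_of_inner_eq_zero (𝕜 := ℝ) ?_ ?_
    · intro k
      fin_cases k
      · exact sub_ne_zero.2 (M.crossing_ne_primaryCenter e i hi).symm
      · exact sub_ne_zero.2 (M.crossing_ne_dualCenter e ν hν).symm
    · have ho := M.orthogonal e i hi ν hν
      intro j k hjk
      fin_cases j <;> fin_cases k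
      · exact absurd rfl hjk
      · exact ho
      · exact (real_inner_comm _ _).trans ho
      · exact absurd rfl hjk
  have hspan := hli.span_eq_top_of_card_eq_finrank (by simp)
  change (interior (convexHull ℝ S)).Nonempty
  rw [interior_convexHull_nonempty_iff_affineSpan_eq_top,
    ← AffineSubspace.direction_eq_top_iff_of_nonempty ⟨_, hy⟩, eq_top_iff, ← hspan,
    Submodule.span_le]
  rintro _ ⟨k, rfl⟩
  fin_cases k
  · exact AffineSubspace.vsub_mem_direction hx hy
  · exact AffineSubspace.vsub_mem_direction hz hy

/-- `∑ i, φ_i χ_i`. -/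
def primaryField [Fintype I] : (I → ℝ) →ₗ[ℝ] (Plane → ℝ) := cellField M.primaryCell fun _ => 1

/-- `∑ ν, ψ_ν χ_ν`. -/
def dualField [Fintype N] : (N → ℝ) →ₗ[ℝ] (Plane → ℝ) := cellField M.dualCell fun _ => 1

/-- `∑ e, u_e χ_e n_e`. -/
def edgeField [Fintype E] : (E → ℝ) →ₗ[ℝ] (Plane → Plane) := cellField M.diamond M.normal

/-- `Φ_h`, the scalar fields on the primary mesh. -/
def Phi [Fintype I] : Submodule ℝ (Plane → ℝ) := LinearMap.range M.primaryField

/-- `Ψ_h`, the scalar fields on the dual mesh. -/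
def Psi [Fintype N] : Submodule ℝ (Plane → ℝ) := LinearMap.range M.dualField

/-- `V_h`, the discrete vector fields. -/
def V [Fintype E] : Submodule ℝ (Plane → Plane) := LinearMap.range M.edgeField

theorem primaryField_injective [Fintype I] : Function.Injective M.primaryField :=
  cellField_injective _ _ (fun _ => one_ne_zero) M.interior_primaryCell_nonempty
    M.primaryCell_disjoint

theorem dualField_injective [Fintype N] : Function.Injective M.dualField :=
  cellField_injective _ _ (fun _ => one_ne_zero) M.interior_dualCell_nonempty
    M.dualCell_disjoint

theorem edgeField_injective [Fintype E] : Function.Injective M.edgeField :=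
  cellField_injective _ _ M.normal_ne_zero M.interior_diamond_nonempty M.diamond_disjoint

/-- A field `φ_h ∈ Φ_h` corresponds to its values `φ_i`. -/
def primaryEquiv [Fintype I] : (I → ℝ) ≃ₗ[ℝ] M.Phi :=
  LinearEquiv.ofInjective M.primaryField M.primaryField_injective

/-- A field `ψ_h ∈ Ψ_h` corresponds to its values `ψ_ν`. -/
def dualEquiv [Fintype N] : (N → ℝ) ≃ₗ[ℝ] M.Psi :=
  LinearEquiv.ofInjective M.dualField M.dualField_injective

/-- A field `u_h ∈ V_h` corresponds to its normal components `u_e`. -/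
def edgeEquiv [Fintype E] : (E → ℝ) ≃ₗ[ℝ] M.V :=
  LinearEquiv.ofInjective M.edgeField M.edgeField_injective

/-- The discrete gradient `[∇_h φ_h]_e = -1 / d_e * ∑ i ∈ CE(e), φ_i n_{e,i}`. -/
def grad [Fintype I] [Fintype E] (φ : M.Phi) : M.V :=
  M.edgeEquiv fun e =>
    -1 / M.dualLength e * ∑ i ∈ M.CE e, M.primaryEquiv.symm φ i * M.nSign e i

/-- The discrete curl `[∇_h × u_h]_ν = -1 / A_ν * ∑ e ∈ EV(ν), u_e d_e t_{e,ν}`, where `A_ν` is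
the area of the dual cell. -/
def curl [Fintype N] [Fintype E] (u : M.V) : M.Psi :=
  M.dualEquiv fun ν =>
    -1 / (MeasureTheory.volume (M.dualCell ν)).toReal *
      ∑ e ∈ M.EV ν, M.edgeEquiv.symm u e * M.dualLength e * M.tSign e ν

end StaggeredMesh

end StaggeredGrid

end

noncomputable section

namespace StaggeredGrid

open Filter Topology

/-! Put w_e = u_e d_e. A vanishing curl means that Σ w_e t_{e,ν} = 0 over the edges at each dual
centre x_ν; being a gradient means that w_e is, up to sign, the jump of a function on the primary
cells across the primary edge e. So the claim is that prescribed jumps come from a piecewise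
constant function exactly when they add up to zero around every x_ν.

For existence no paths are followed: the function is written down. The principal branch of log((y_e
- z)/(x_ν - z)) is holomorphic off the segment [x_ν, y_e] and jumps by 2πi across it. Let F be the
sum of these logarithms with weights w_e t_{e,ν}. In F' the coefficient of the pole at x_ν is -Σ w_e
t_{e,ν} = 0, and the poles at y_e cancel between the two halves of an interior edge. For a boundary
edge, y_e is outside Ω, and simple connectedness provides a primitive of 1/(z - y_e) on Ω to
subtract (`exists_branch`). Hence F is a constant C_i inside each A_i, and -Im C_i/(2π) is the
potential (`exists_potential`).

Conversely, along a small circle around x_ν a field of Φ_h is a step function that jumps only at the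
edges ending in x_ν. After one turn it returns to its value, so the jumps add up to zero
(`sum_jump_eq_zero`).

Both directions rest on local geometry: near an inner point of a half edge, the side facing x_i
belongs to A_i (`eventually_mem_interior_primaryCell`), and such points and all x_ν lie in Ω
(`openSegment_subset_domain`, `dualCenter_mem_domain`), because Ω is the interior of its closure. -/

theorem inner_eq_coord (v w : Plane) : inner ℝ v w = v 0 * w 0 + v 1 * w 1 := by
  simp [PiLp.inner_apply, Fin.sum_univ_two, mul_comm]

theorem norm_sq_eq_coord (v : Plane) : ‖v‖ ^ 2 = v 0 ^ 2 + v 1 ^ 2 := by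
  rw [← real_inner_self_eq_norm_sq, inner_eq_coord]; ring

@[simp] theorem rot_apply_zero (v : Plane) : rot v 0 = -(v 1) := rfl

@[simp] theorem rot_apply_one (v : Plane) : rot v 1 = v 0 := rfl

theorem norm_rot (v : Plane) : ‖rot v‖ = ‖v‖ := by
  rw [← sq_eq_sq₀ (norm_nonneg _) (norm_nonneg _), norm_sq_eq_coord, norm_sq_eq_coord]
  simp; ring

theorem eq_inner_smul_add_inner_rot_smul {n : Plane} (hn : ‖n‖ = 1) (q : Plane) :
    q = inner ℝ n q • n + inner ℝ (rot n) q • rot n := by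
  have h : n 0 ^ 2 + n 1 ^ 2 = 1 := by rw [← norm_sq_eq_coord, hn]; norm_num
  ext k
  fin_cases k <;> simp [inner_eq_coord] <;> linear_combination (-q _) * h

theorem dense_inner_ne {n : Plane} (hn : n ≠ 0) (y : Plane) :
    Dense {q : Plane | inner ℝ n (q - y) ≠ 0} := by
  intro q
  by_cases hq : inner ℝ n (q - y) = 0
  · have ht : Tendsto (fun t : ℝ => q + t • n) (𝓝[>] 0) (𝓝 q) := by
      have : Continuous fun t : ℝ => q + t • n := by fun_prop
      simpa using (this.tendsto 0).mono_left nhdsWithin_le_nhds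
    refine mem_closure_of_tendsto ht ?_
    filter_upwards [self_mem_nhdsWithin] with t ht
    have hn2 : inner ℝ n n ≠ 0 := inner_self_ne_zero.2 hn
    have : inner ℝ n (q + t • n - y) = t * inner ℝ n n := by
      rw [show q + t • n - y = (q - y) + t • n by abel, inner_add_right, hq, inner_smul_right,
        zero_add]
    exact this ▸ mul_ne_zero (ne_of_gt ht) hn2
  · exact subset_closure hq

/-! ### Orthogonal coordinates attached to an edge pair -/

namespace StaggeredMesh

variable {Ω : Set Plane} {I N E : Type*} (M : StaggeredMesh Ω I N E)

/-- The coordinate of `q` along the normal of the pair `e`, with origin at the crossing. -/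
def ncoord (e : E) (q : Plane) : ℝ := inner ℝ (M.normal e) (q - M.crossing e)

/-- The coordinate of `q` along the tangent of the pair `e`, with origin at the crossing. -/
def tcoord (e : E) (q : Plane) : ℝ := inner ℝ (M.tangent e) (q - M.crossing e)

theorem continuous_tcoord (e : E) : Continuous (M.tcoord e) := by
  unfold tcoord; fun_prop

theorem norm_tangent (e : E) : ‖M.tangent e‖ = 1 := by
  rw [MeshData.tangent, norm_rot, M.norm_normal]

theorem inner_combo (w y p q : Plane) {a b : ℝ} (h : a + b = 1) :
    inner ℝ w (a • p + b • q - y) = a * inner ℝ w (p - y) + b * inner ℝ w (q - y) := by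
  rw [← inner_smul_right, ← inner_smul_right, ← inner_add_right]
  congr 1
  rw [smul_sub, smul_sub]
  nth_rewrite 1 [← one_smul ℝ y]
  rw [← h, add_smul]; abel

theorem ncoord_combo (e : E) (p q : Plane) {a b : ℝ} (h : a + b = 1) :
    M.ncoord e (a • p + b • q) = a * M.ncoord e p + b * M.ncoord e q := inner_combo _ _ _ _ h

theorem tcoord_combo (e : E) (p q : Plane) {a b : ℝ} (h : a + b = 1) :
    M.tcoord e (a • p + b • q) = a * M.tcoord e p + b * M.tcoord e q := inner_combo _ _ _ _ h

@[simp] theorem ncoord_crossing (e : E) : M.ncoord e (M.crossing e) = 0 := by simp [ncoord]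

@[simp] theorem tcoord_crossing (e : E) : M.tcoord e (M.crossing e) = 0 := by simp [tcoord]

theorem sub_crossing_eq (e : E) (q : Plane) :
    q - M.crossing e = M.ncoord e q • M.normal e + M.tcoord e q • M.tangent e :=
  eq_inner_smul_add_inner_rot_smul (M.norm_normal e) _

theorem eq_of_coord_eq {e : E} {p q : Plane} (hn : M.ncoord e p = M.ncoord e q)
    (ht : M.tcoord e p = M.tcoord e q) : p = q := by
  have := M.sub_crossing_eq e p
  rw [hn, ht, ← M.sub_crossing_eq] at this
  exact sub_left_injective this

variable {M} {e : E} {i j : I} {ν μ : N}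

theorem VE_nonempty (M : StaggeredMesh Ω I N E) (e : E) : (M.VE e).Nonempty := by
  rw [← Finset.card_pos]
  by_cases h : M.dualEdge e ⊆ frontier Ω
  · rw [M.card_VE_boundary e h]; norm_num
  · rw [M.card_VE_interior e h]; norm_num

theorem ncoord_dualCenter (hν : ν ∈ M.VE e) : M.ncoord e (M.dualCenter ν) = 0 :=
  M.normal_orthogonal e ν hν

theorem tcoord_dualCenter_ne_zero (hν : ν ∈ M.VE e) : M.tcoord e (M.dualCenter ν) ≠ 0 := by
  intro h
  refine M.crossing_ne_dualCenter e ν hν (M.eq_of_coord_eq (e := e) ?_ ?_)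
  · rw [ncoord_dualCenter hν, ncoord_crossing]
  · rw [h, tcoord_crossing]

/-- The vector x_ν - y_e is a nonzero multiple of t_e, so orthogonality to it kills the tangential
coordinate. -/
theorem tcoord_primaryCenter (hi : i ∈ M.CE e) : M.tcoord e (M.primaryCenter i) = 0 := by
  obtain ⟨ν, hν⟩ := M.VE_nonempty e
  have h := M.orthogonal e i hi ν hν
  rw [M.sub_crossing_eq e (M.dualCenter ν), ncoord_dualCenter hν, zero_smul, zero_add,
    inner_smul_right, real_inner_comm] at h
  exact (mul_eq_zero.1 h).resolve_left (tcoord_dualCenter_ne_zero hν)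

theorem ncoord_primaryCenter_ne_zero (hi : i ∈ M.CE e) : M.ncoord e (M.primaryCenter i) ≠ 0 := by
  intro h
  refine M.crossing_ne_primaryCenter e i hi (M.eq_of_coord_eq (e := e) ?_ ?_)
  · rw [h, ncoord_crossing]
  · rw [tcoord_primaryCenter hi, tcoord_crossing]

theorem exists_CE_eq (hi : i ∈ M.CE e) : ∃ j, j ≠ i ∧ (M.CE e : Set I) = {i, j} := by
  classical
  obtain ⟨a, b, hab, h⟩ := Finset.card_eq_two.1 (M.card_CE e)
  rw [h] at hi ⊢
  rcases Finset.mem_insert.1 hi with rfl | hi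
  · exact ⟨b, hab.symm, by simp⟩
  · rw [Finset.mem_singleton] at hi
    subst hi
    exact ⟨a, hab, by simp [Set.pair_comm]⟩

theorem mem_CE_iff_of_eq (h : (M.CE e : Set I) = {i, j}) {k : I} :
    k ∈ M.CE e ↔ k = i ∨ k = j := by
  rw [← Finset.mem_coe, h]; simp

theorem dualEdge_eq_segment (h : (M.CE e : Set I) = {i, j}) :
    M.dualEdge e = segment ℝ (M.primaryCenter i) (M.primaryCenter j) := by
  rw [MeshData.dualEdge, h, image_pair, convexHull_pair]

/-- The crossing has coordinate 0 and is a convex combination of the two centres; both weights are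
nonzero because neither centre has coordinate 0. -/
theorem ncoord_mul_neg_of_CE_eq (h : (M.CE e : Set I) = {i, j}) :
    M.ncoord e (M.primaryCenter i) * M.ncoord e (M.primaryCenter j) < 0 := by
  have hi : i ∈ M.CE e := (mem_CE_iff_of_eq h).2 (Or.inl rfl)
  have hj : j ∈ M.CE e := (mem_CE_iff_of_eq h).2 (Or.inr rfl)
  have hc := M.crossing_mem_dual e
  rw [dualEdge_eq_segment h] at hc
  obtain ⟨a, b, ha, hb, hab, hc⟩ := hc
  have h1 := congrArg (M.ncoord e) hc
  rw [ncoord_combo _ _ _ _ hab, ncoord_crossing] at h1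
  have hi0 := ncoord_primaryCenter_ne_zero hi
  have hj0 := ncoord_primaryCenter_ne_zero hj
  have ha0 : a ≠ 0 := by
    rintro rfl
    rw [zero_add] at hab
    subst hab
    exact hj0 (by simpa using h1)
  have hb0 : b ≠ 0 := by
    rintro rfl
    rw [add_zero] at hab
    subst hab
    exact hi0 (by simpa using h1)
  have ha' : 0 < a := lt_of_le_of_ne ha ha0.symm
  have hb' : 0 < b := lt_of_le_of_ne hb hb0.symm
  have h2 : a * (M.ncoord e (M.primaryCenter i) * M.ncoord e (M.primaryCenter j)) =
      -(b * M.ncoord e (M.primaryCenter j) ^ 2) := by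
    linear_combination M.ncoord e (M.primaryCenter j) * h1
  have h3 : 0 < b * M.ncoord e (M.primaryCenter j) ^ 2 := by positivity
  by_contra hcon
  nlinarith [mul_nonneg ha (not_lt.1 hcon)]

theorem nSign_eq (M : StaggeredMesh Ω I N E) (e : E) (i : I) :
    M.nSign e i = if M.ncoord e (M.primaryCenter i) < 0 then 1 else -1 := by
  rw [MeshData.nSign, ncoord, ← neg_sub (M.primaryCenter i), inner_neg_right]
  simp

theorem tSign_eq (M : StaggeredMesh Ω I N E) (e : E) (ν : N) :
    M.tSign e ν = if M.tcoord e (M.dualCenter ν) < 0 then 1 else -1 := by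
  rw [MeshData.tSign, tcoord, ← neg_sub (M.dualCenter ν), inner_neg_right]
  simp

theorem nSign_mul_ncoord_neg (hi : i ∈ M.CE e) :
    M.nSign e i * M.ncoord e (M.primaryCenter i) < 0 := by
  have := ncoord_primaryCenter_ne_zero hi
  rw [nSign_eq]
  split_ifs with h
  · linarith
  · have := lt_of_le_of_ne (not_lt.1 h) this.symm
    linarith

theorem tSign_mul_tcoord_neg (hν : ν ∈ M.VE e) :
    M.tSign e ν * M.tcoord e (M.dualCenter ν) < 0 := by
  have := tcoord_dualCenter_ne_zero hν
  rw [tSign_eq]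
  split_ifs with h
  · linarith
  · have := lt_of_le_of_ne (not_lt.1 h) this.symm
    linarith

theorem nSign_eq_one_or (M : StaggeredMesh Ω I N E) (e : E) (i : I) :
    M.nSign e i = 1 ∨ M.nSign e i = -1 := by
  rw [nSign_eq]; split_ifs <;> simp

theorem tSign_eq_one_or (M : StaggeredMesh Ω I N E) (e : E) (ν : N) :
    M.tSign e ν = 1 ∨ M.tSign e ν = -1 := by
  rw [tSign_eq]; split_ifs <;> simp

theorem nSign_eq_neg_of_CE_eq (h : (M.CE e : Set I) = {i, j}) :
    M.nSign e j = -M.nSign e i := by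
  have := ncoord_mul_neg_of_CE_eq h
  rw [nSign_eq, nSign_eq]
  split_ifs with h1 h2 h2 <;> norm_num
  · nlinarith
  · nlinarith

theorem VE_cases (hν : ν ∈ M.VE e) :
    (M.dualEdge e ⊆ frontier Ω ∧ (M.VE e : Set N) = {ν}) ∨
    (¬ M.dualEdge e ⊆ frontier Ω ∧ ∃ μ, μ ≠ ν ∧ (M.VE e : Set N) = {ν, μ} ∧
      M.tcoord e (M.dualCenter ν) * M.tcoord e (M.dualCenter μ) < 0) := by
  classical
  by_cases h : M.dualEdge e ⊆ frontier Ω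
  · left
    obtain ⟨a, ha⟩ := Finset.card_eq_one.1 (M.card_VE_boundary e h)
    rw [ha] at hν ⊢
    rw [Finset.mem_singleton] at hν
    subst hν
    exact ⟨h, by simp⟩
  · right
    refine ⟨h, ?_⟩
    have : ∃ μ, μ ≠ ν ∧ (M.VE e : Set N) = {ν, μ} := by
      obtain ⟨a, b, hab, h⟩ := Finset.card_eq_two.1 (M.card_VE_interior e h)
      rw [h] at hν ⊢
      rcases Finset.mem_insert.1 hν with rfl | hν
      · exact ⟨b, hab.symm, by simp⟩
      · rw [Finset.mem_singleton] at hν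
        subst hν
        exact ⟨a, hab, by simp [Set.pair_comm]⟩
    obtain ⟨μ, hμν, hVE⟩ := this
    refine ⟨μ, hμν, hVE, ?_⟩
    have hμ : μ ∈ M.VE e := by rw [← Finset.mem_coe, hVE]; simp
    have hc := M.crossing_mem_primary e h
    rw [hVE, image_pair, convexHull_pair] at hc
    obtain ⟨a, b, ha, hb, hab, hc⟩ := hc
    have h1 := congrArg (M.tcoord e) hc
    rw [tcoord_combo _ _ _ _ hab, tcoord_crossing] at h1
    have hi0 := tcoord_dualCenter_ne_zero hν
    have hj0 := tcoord_dualCenter_ne_zero hμ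
    have ha0 : a ≠ 0 := by
      rintro rfl
      rw [zero_add] at hab
      subst hab
      exact hj0 (by simpa using h1)
    have hb0 : b ≠ 0 := by
      rintro rfl
      rw [add_zero] at hab
      subst hab
      exact hi0 (by simpa using h1)
    have ha' : 0 < a := lt_of_le_of_ne ha ha0.symm
    have hb' : 0 < b := lt_of_le_of_ne hb hb0.symm
    have h2 : a * (M.tcoord e (M.dualCenter ν) * M.tcoord e (M.dualCenter μ)) =
        -(b * M.tcoord e (M.dualCenter μ) ^ 2) := by
      linear_combination M.tcoord e (M.dualCenter μ) * h1
    have h3 : 0 < b * M.tcoord e (M.dualCenter μ) ^ 2 := by positivity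
    by_contra hcon
    nlinarith [mul_nonneg ha (not_lt.1 hcon)]

theorem tSign_eq_neg (h : M.tcoord e (M.dualCenter ν) * M.tcoord e (M.dualCenter μ) < 0) :
    M.tSign e μ = -M.tSign e ν := by
  rw [tSign_eq, tSign_eq]
  split_ifs with h1 h2 h2 <;> norm_num
  · nlinarith
  · nlinarith

theorem sum_tSign_eq_zero (h : ¬ M.dualEdge e ⊆ frontier Ω) :
    ∑ ν ∈ M.VE e, M.tSign e ν = 0 := by
  classical
  obtain ⟨ν, hν⟩ := M.VE_nonempty e
  rcases VE_cases hν with h1 | ⟨-, μ, hμ, hVE, hneg⟩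
  · exact absurd h1.1 h
  · have : M.VE e = {ν, μ} := by ext; rw [← Finset.mem_coe, hVE]; simp
    rw [this, Finset.sum_pair hμ.symm, tSign_eq_neg hneg]; ring

theorem tcoord_eq_zero_of_mem_dualEdge {q : Plane} (hq : q ∈ M.dualEdge e) :
    M.tcoord e q = 0 := by
  have hs : Convex ℝ {q | M.tcoord e q = 0} := by
    intro p hp q hq a b _ _ hab
    rw [mem_ofPred_eq] at *
    rw [tcoord_combo _ _ _ _ hab, hp, hq]; ring
  refine convexHull_min ?_ hs hq
  rintro _ ⟨i, hi, rfl⟩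
  exact tcoord_primaryCenter hi

theorem ncoord_eq_zero_of_mem_primaryEdge {q : Plane} (hq : q ∈ M.primaryEdge e) :
    M.ncoord e q = 0 := by
  have hs : Convex ℝ {q | M.ncoord e q = 0} := by
    intro p hp q hq a b _ _ hab
    rw [mem_ofPred_eq] at *
    rw [ncoord_combo _ _ _ _ hab, hp, hq]; ring
  refine convexHull_min (insert_subset (by simp) ?_) hs hq
  rintro _ ⟨i, hi, rfl⟩
  exact ncoord_dualCenter hi

/-- The edge does not extend beyond x_ν, since its other generators have tangential coordinate 0 or
of the opposite sign. This later separates the direction of an edge at x_ν from the reverse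
direction. -/
theorem tcoord_mul_le_of_mem_primaryEdge {q : Plane} (hq : q ∈ M.primaryEdge e)
    (hν : ν ∈ M.VE e) :
    M.tcoord e q * M.tcoord e (M.dualCenter ν) ≤ M.tcoord e (M.dualCenter ν) ^ 2 := by
  have hs : Convex ℝ {q | M.tcoord e q * M.tcoord e (M.dualCenter ν) ≤
      M.tcoord e (M.dualCenter ν) ^ 2} := by
    intro p hp q hq a b ha hb hab
    rw [mem_ofPred_eq] at *
    rw [tcoord_combo _ _ _ _ hab]
    have h1 := mul_le_mul_of_nonneg_left hp ha
    have h2 := mul_le_mul_of_nonneg_left hq hb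
    have h3 : (a + b) * M.tcoord e (M.dualCenter ν) ^ 2 = M.tcoord e (M.dualCenter ν) ^ 2 := by
      rw [hab, one_mul]
    linarith
  refine convexHull_min (insert_subset ?_ ?_) hs hq
  · simp [sq_nonneg]
  rintro _ ⟨κ, hκ, rfl⟩
  rw [mem_ofPred_eq]
  rcases VE_cases hν with ⟨-, h⟩ | ⟨-, μ, hμ, h, hneg⟩
  · rw [h] at hκ
    rw [mem_singleton_iff.1 hκ, sq]
  · rw [h] at hκ
    rcases hκ with rfl | hκ
    · rw [sq]
    · rw [mem_singleton_iff.1 hκ]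
      nlinarith [sq_nonneg (M.tcoord e (M.dualCenter ν))]

theorem mem_openSegment_iff (hν : ν ∈ M.VE e) {q : Plane} :
    q ∈ openSegment ℝ (M.dualCenter ν) (M.crossing e) ↔ M.ncoord e q = 0 ∧
      0 < M.tcoord e q * M.tcoord e (M.dualCenter ν) ∧
      M.tcoord e q * M.tcoord e (M.dualCenter ν) < M.tcoord e (M.dualCenter ν) ^ 2 := by
  have hb := tcoord_dualCenter_ne_zero hν
  have hb2 : 0 < M.tcoord e (M.dualCenter ν) ^ 2 := by positivity
  constructor
  · rintro ⟨a, b, ha, hb, hab, rfl⟩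
    rw [ncoord_combo _ _ _ _ hab, tcoord_combo _ _ _ _ hab, ncoord_dualCenter hν,
      ncoord_crossing, tcoord_crossing]
    refine ⟨by ring, ?_, ?_⟩
    · have := mul_pos ha hb2
      nlinarith
    · have := mul_pos hb hb2
      have h3 : (a + b) * M.tcoord e (M.dualCenter ν) ^ 2 = M.tcoord e (M.dualCenter ν) ^ 2 := by
        rw [hab, one_mul]
      nlinarith
  · rintro ⟨h0, h1, h2⟩
    have hs : M.tcoord e q / M.tcoord e (M.dualCenter ν) =
        M.tcoord e q * M.tcoord e (M.dualCenter ν) / M.tcoord e (M.dualCenter ν) ^ 2 := by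
      field_simp
    refine ⟨M.tcoord e q / M.tcoord e (M.dualCenter ν),
      1 - M.tcoord e q / M.tcoord e (M.dualCenter ν), ?_, ?_, by ring, ?_⟩
    · rw [hs]; positivity
    · rw [hs, sub_pos, div_lt_one hb2]; exact h2
    · refine M.eq_of_coord_eq (e := e) ?_ ?_
      · rw [ncoord_combo _ _ _ _ (by ring), h0, ncoord_dualCenter hν, ncoord_crossing]; ring
      · rw [tcoord_combo _ _ _ _ (by ring), tcoord_crossing]; field_simp; ring

theorem openSegment_subset_primaryEdge (hν : ν ∈ M.VE e) :
    openSegment ℝ (M.dualCenter ν) (M.crossing e) ⊆ M.primaryEdge e :=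
  (convex_convexHull ℝ _).openSegment_subset
    (subset_convexHull ℝ _ (mem_insert_of_mem _ ⟨ν, hν, rfl⟩))
    (subset_convexHull ℝ _ (mem_insert _ _))

theorem dualLength_eq (h : (M.CE e : Set I) = {i, j}) :
    M.dualLength e = dist (M.primaryCenter i) (M.primaryCenter j) := by
  rw [MeshData.dualLength, MeshData.dualEdge, convexHull_diam, h, image_pair, Metric.diam_pair]

theorem dualLength_pos (M : StaggeredMesh Ω I N E) (e : E) : 0 < M.dualLength e := by
  obtain ⟨i, hi⟩ : (M.CE e).Nonempty := by
    rw [← Finset.card_pos, M.card_CE e]; norm_num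
  obtain ⟨j, hj, h⟩ := exists_CE_eq hi
  rw [dualLength_eq h, dist_pos]
  exact M.primaryCenter_injective.ne hj.symm

end StaggeredMesh

/-! ### The domain is the interior of its closure -/

/-- An opening angle below 2π excludes slits: at a boundary point some ray leaves in a direction
missed by the closed sector, so the point cannot be interior to the closure. -/
theorem IsPolygonalDomain.interior_closure {Ω : Set Plane} (hΩ : IsPolygonalDomain Ω) :
    interior (closure Ω) = Ω := by
  refine Subset.antisymm (fun x hx => ?_) (interior_maximal subset_closure hΩ.isOpen)
  by_contra hxΩ
  have hxf : x ∈ frontier Ω := by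
    rw [frontier, hΩ.isOpen.interior_eq]
    exact ⟨interior_subset hx, hxΩ⟩
  obtain ⟨r, α, β, hr, hαβ, hβ, hs⟩ := hΩ.locally_sector x hxf
  obtain ⟨θ, h1, h2⟩ := exists_between hβ
  let g : ℝ × ℝ → Plane := fun z => x + z.1 • !₂[Real.cos z.2, Real.sin z.2]
  have hg : Continuous g := by
    refine continuous_const.add (continuous_fst.smul ?_)
    refine (PiLp.continuous_toLp 2 _).comp (continuous_pi fun k => ?_)
    fin_cases k
    · exact Real.continuous_cos.comp continuous_snd
    · exact Real.continuous_sin.comp continuous_snd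
  -- The closed sector is a compact image under polar coordinates, so points of the closure still
  -- have an angle in [α, β].
  have hcl : closure (Ω ∩ Metric.ball x r) ⊆ g '' (Icc 0 r ×ˢ Icc α β) := by
    refine closure_minimal ?_ ((isCompact_Icc.prod isCompact_Icc).image hg).isClosed
    rw [hs]
    rintro _ ⟨ρ, φ, hρ, hρr, hα, hβ, rfl⟩
    exact ⟨(ρ, φ), ⟨⟨hρ.le, hρr.le⟩, hα.le, hβ.le⟩, rfl⟩
  have ht : Tendsto (fun ρ : ℝ => g (ρ, θ)) (𝓝[>] 0) (𝓝 x) := by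
    have : Continuous fun ρ : ℝ => g (ρ, θ) := hg.comp (by fun_prop)
    simpa [g] using (this.tendsto 0).mono_left nhdsWithin_le_nhds
  have hev : ∀ᶠ ρ : ℝ in 𝓝[>] 0, g (ρ, θ) ∈ interior (closure Ω) ∩ Metric.ball x r :=
    ht.eventually ((isOpen_interior.inter Metric.isOpen_ball).mem_nhds
      ⟨hx, Metric.mem_ball_self hr⟩)
  obtain ⟨ρ, ⟨hρ1, hρ2⟩, hρ0⟩ := (hev.and self_mem_nhdsWithin).exists
  have hmem : g (ρ, θ) ∈ closure (Ω ∩ Metric.ball x r) :=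
    Metric.isOpen_ball.closure_inter ⟨interior_subset hρ1, hρ2⟩
  obtain ⟨⟨ρ', θ'⟩, ⟨⟨hρ', -⟩, hα', hβ'⟩, heq⟩ := hcl hmem
  simp only at hρ' hα' hβ'
  have hv := add_left_cancel heq
  have e0 : ρ' * Real.cos θ' = ρ * Real.cos θ := by simpa using congrArg (fun v => v 0) hv
  have e1 : ρ' * Real.sin θ' = ρ * Real.sin θ := by simpa using congrArg (fun v => v 1) hv
  have c1 := Real.sin_sq_add_cos_sq θ
  have c2 := Real.sin_sq_add_cos_sq θ'
  have hsq : ρ' ^ 2 = ρ ^ 2 := by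
    have : ρ' ^ 2 * (Real.sin θ' ^ 2 + Real.cos θ' ^ 2) =
        ρ ^ 2 * (Real.sin θ ^ 2 + Real.cos θ ^ 2) := by
      linear_combination (ρ' * Real.sin θ' + ρ * Real.sin θ) * e1 +
        (ρ' * Real.cos θ' + ρ * Real.cos θ) * e0
    rwa [c1, c2, mul_one, mul_one] at this
  have hρeq : ρ' = ρ := (sq_eq_sq₀ hρ' hρ0.le).1 hsq
  rw [hρeq] at e0 e1
  have e0' := mul_left_cancel₀ hρ0.ne' e0
  have e1' := mul_left_cancel₀ hρ0.ne' e1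
  -- Equal polar points have angles differing by a multiple of 2π, but here 0 < θ - θ' < 2π.
  have hcos : Real.cos (θ - θ') = 1 := by
    rw [Real.cos_sub, e0', e1']; linear_combination c1
  have := (Real.cos_eq_one_iff_of_lt_of_lt (by linarith [Real.pi_pos]) (by linarith)).1 hcos
  linarith

/-! ### Cells on the two sides of a primary edge -/

namespace StaggeredMesh

variable {Ω : Set Plane} {I N E : Type*} {M : StaggeredMesh Ω I N E} {e f : E} {i j : I} {ν μ : N}

theorem isClosed_primaryCell (M : StaggeredMesh Ω I N E) (i : I) : IsClosed (M.primaryCell i) := by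
  obtain ⟨n, v, hv, -⟩ := M.primaryCell_polygon i
  exact hv.isCompact.isClosed

theorem closure_interior_primaryCell (M : StaggeredMesh Ω I N E) (i : I) :
    closure (interior (M.primaryCell i)) = M.primaryCell i := by
  obtain ⟨n, v, hv, -⟩ := M.primaryCell_polygon i
  exact hv.closure_interior

theorem isConnected_interior_primaryCell (M : StaggeredMesh Ω I N E) (i : I) :
    IsConnected (interior (M.primaryCell i)) := by
  obtain ⟨n, v, hv, -⟩ := M.primaryCell_polygon i
  exact hv.interior_connected

theorem mem_frontier_primaryCell {q : Plane} : q ∈ frontier (M.primaryCell i) ↔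
    (∃ e, i ∈ M.CE e ∧ q ∈ M.primaryEdge e) ∨
    ∃ e, i ∈ M.CE e ∧ M.dualEdge e ⊆ frontier Ω ∧
      q ∈ segment ℝ (M.primaryCenter i) (M.crossing e) := by
  obtain ⟨n, v, hv, hs⟩ := M.primaryCell_polygon i
  rw [hv.frontier_eq, ← sUnion_range, hs, sUnion_union, mem_union, mem_sUnion, mem_sUnion]
  constructor
  · rintro (⟨_, ⟨e, he, rfl⟩, hq⟩ | ⟨_, ⟨e, he, he', rfl⟩, hq⟩)
    · exact Or.inl ⟨e, he, hq⟩
    · exact Or.inr ⟨e, he, he', hq⟩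
  · rintro (⟨e, he, hq⟩ | ⟨e, he, he', hq⟩)
    · exact Or.inl ⟨_, ⟨e, he, rfl⟩, hq⟩
    · exact Or.inr ⟨_, ⟨e, he, he', rfl⟩, hq⟩

theorem primaryEdge_subset_primaryCell (hi : i ∈ M.CE e) :
    M.primaryEdge e ⊆ M.primaryCell i := fun _ hq =>
  (isClosed_primaryCell M i).frontier_subset (mem_frontier_primaryCell.2 (Or.inl ⟨e, hi, hq⟩))

theorem disjoint_interior_primaryCell (h : i ≠ j) :
    Disjoint (interior (M.primaryCell i)) (M.primaryCell j) := by
  rw [← closure_interior_primaryCell M j]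
  exact (M.primaryCell_disjoint i j h).closure_right isOpen_interior

theorem disjoint_interior_primaryCell_primaryEdge (M : StaggeredMesh Ω I N E) (i : I) (e : E) :
    Disjoint (interior (M.primaryCell i)) (M.primaryEdge e) := by
  by_cases hi : i ∈ M.CE e
  · rw [Set.disjoint_right]
    intro q hq
    exact (mem_frontier_primaryCell.2 (Or.inl ⟨e, hi, hq⟩) :
      q ∈ frontier (M.primaryCell i)).2
  · obtain ⟨j, hj⟩ : (M.CE e).Nonempty := by
      rw [← Finset.card_pos, M.card_CE e]; norm_num
    exact (disjoint_interior_primaryCell (j := j) (by rintro rfl; exact hi hj)).mono_right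
      (primaryEdge_subset_primaryCell hj)

theorem primaryCenter_mem_dualEdge (hi : i ∈ M.CE e) : M.primaryCenter i ∈ M.dualEdge e :=
  subset_convexHull ℝ _ ⟨i, hi, rfl⟩

theorem segment_subset_dualEdge (hi : i ∈ M.CE e) :
    segment ℝ (M.primaryCenter i) (M.crossing e) ⊆ M.dualEdge e :=
  (convex_convexHull ℝ _).segment_subset (primaryCenter_mem_dualEdge hi) (M.crossing_mem_dual e)

theorem crossing_mem_primaryEdge (M : StaggeredMesh Ω I N E) (e : E) :
    M.crossing e ∈ M.primaryEdge e := subset_convexHull ℝ _ (mem_insert _ _)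

theorem crossing_notMem_dualEdge (h : e ≠ f) : M.crossing e ∉ M.dualEdge f := fun hf =>
  Set.disjoint_left.1 (M.primaryEdge_dualEdge e f h) (crossing_mem_primaryEdge M e) hf

theorem crossing_notMem_primaryEdge (h : e ≠ f) : M.crossing e ∉ M.primaryEdge f := fun hf =>
  Set.disjoint_left.1 (M.primaryEdge_dualEdge f e h.symm) hf (M.crossing_mem_dual e)

/-- The half of the dual edge on the side of x_j avoids every side of A_i. Another primary edge
cannot meet it, and the sides on the edge pair e itself have normal coordinate 0 or of the sign of
x_i. A boundary segment of another pair f could touch it only at x_j; then f would also join x_i and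
x_j, and its dual edge would contain y_e, which is excluded. -/
theorem notMem_frontier_primaryCell (h : (M.CE e : Set I) = {i, j}) {z : Plane}
    (hz : z ∈ M.dualEdge e) (hpos : 0 < M.ncoord e z * M.ncoord e (M.primaryCenter j)) :
    z ∉ frontier (M.primaryCell i) := by
  have hneg := ncoord_mul_neg_of_CE_eq h
  rw [mem_frontier_primaryCell]
  rintro (⟨f, hf, hzf⟩ | ⟨f, hf, -, hzf⟩)
  · by_cases hfe : f = e
    · subst hfe
      rw [ncoord_eq_zero_of_mem_primaryEdge hzf, zero_mul] at hpos
      exact hpos.false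
    · exact Set.disjoint_left.1 (M.primaryEdge_dualEdge f e hfe) hzf hz
  · by_cases hfe : f = e
    · subst hfe
      obtain ⟨a, b, ha, hb, hab, rfl⟩ := hzf
      rw [ncoord_combo _ _ _ _ hab, ncoord_crossing] at hpos
      nlinarith
    · obtain ⟨k, ⟨hke, hkf⟩, rfl⟩ := M.dualEdge_inter e f (Ne.symm hfe)
        ⟨hz, segment_subset_dualEdge hf hzf⟩
      rw [h] at hke
      rcases hke with rfl | hk
      · exact absurd hpos hneg.not_gt
      · rw [mem_singleton_iff] at hk
        subst hk
        have hik : i ≠ k := by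
          rintro rfl
          exact absurd hneg (mul_self_nonneg _).not_gt
        obtain ⟨l, hl, hfl⟩ := exists_CE_eq hf
        have hkl : k = l := by
          rw [hfl] at hkf
          exact hkf.resolve_left hik.symm
        subst hkl
        refine crossing_notMem_dualEdge (Ne.symm hfe) (?_ : M.crossing e ∈ M.dualEdge f)
        rw [dualEdge_eq_segment hfl, ← dualEdge_eq_segment h]
        exact M.crossing_mem_dual e

theorem primaryEdge_closed (M : StaggeredMesh Ω I N E) (e : E) : IsClosed (M.primaryEdge e) := by
  have : (insert (M.crossing e) (M.dualCenter '' M.VE e)).Finite :=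
    ((Finset.finite_toSet _).image _).insert _
  exact (this.isCompact_convexHull ℝ).isClosed

theorem dualEdge_closed (M : StaggeredMesh Ω I N E) (e : E) : IsClosed (M.dualEdge e) := by
  have : (M.primaryCenter '' (M.CE e : Set I)).Finite := (Finset.finite_toSet _).image _
  exact (this.isCompact_convexHull ℝ).isClosed

theorem notMem_primaryEdge_of_mem_openSegment (hν : ν ∈ M.VE e) {m : Plane}
    (hm : m ∈ openSegment ℝ (M.dualCenter ν) (M.crossing e)) (h : f ≠ e) :
    m ∉ M.primaryEdge f := by
  intro hf
  obtain ⟨κ, ⟨hκ, -⟩, rfl⟩ := M.primaryEdge_inter e f h.symm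
    ⟨openSegment_subset_primaryEdge hν hm, hf⟩
  obtain ⟨-, h1, h2⟩ := (mem_openSegment_iff hν).1 hm
  rcases VE_cases hν with ⟨-, hVE⟩ | ⟨-, μ, hμ, hVE, hneg⟩
  · rw [hVE, mem_singleton_iff] at hκ
    subst hκ
    rw [sq] at h2
    exact h2.false
  · rw [hVE] at hκ
    rcases hκ with rfl | hκ
    · rw [sq] at h2
      exact h2.false
    · rw [mem_singleton_iff.1 hκ, mul_comm] at h1
      exact hneg.not_gt h1

/-- The segment [m, y_e] is compact and disjoint from the finite, closed union of all edges of other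
pairs. Near it only the two edges of the pair e remain, and the sign conditions keep q off both. The
segment runs as far as y_e so that the neighbourhood also reaches the dual edge. -/
theorem exists_thickening_avoiding_frontier [Finite E] (hν : ν ∈ M.VE e) {m : Plane}
    (hm : m ∈ openSegment ℝ (M.dualCenter ν) (M.crossing e)) :
    ∃ ε > 0, ∀ q ∈ Metric.thickening ε (segment ℝ m (M.crossing e)), M.ncoord e q ≠ 0 →
      0 < M.tcoord e q * M.tcoord e (M.dualCenter ν) → ∀ i, q ∉ frontier (M.primaryCell i) := by
  have hK : IsClosed (⋃ f : {f : E // f ≠ e}, (M.primaryEdge f ∪ M.dualEdge f)) :=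
    isClosed_iUnion_of_finite fun f => (primaryEdge_closed M f).union (dualEdge_closed M f)
  have hcpt : IsCompact (segment ℝ m (M.crossing e)) := by
    rw [← convexHull_pair]
    exact (Set.toFinite _).isCompact_convexHull ℝ
  have hsub : segment ℝ m (M.crossing e) ⊆
      (⋃ f : {f : E // f ≠ e}, (M.primaryEdge f ∪ M.dualEdge f))ᶜ := by
    intro z hz hzK
    obtain ⟨⟨f, hf⟩, hzf⟩ := mem_iUnion.1 hzK
    have hme := openSegment_subset_primaryEdge hν hm
    have hze : z ∈ M.primaryEdge e := (convex_convexHull ℝ _).segment_subset hme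
      (crossing_mem_primaryEdge M e) hz
    rcases hzf with hzf | hzf
    · by_cases hzc : z = M.crossing e
      · subst hzc
        exact crossing_notMem_primaryEdge hf.symm hzf
      · refine notMem_primaryEdge_of_mem_openSegment hν ?_ hf hzf
        obtain ⟨a, b, ha, hb, hab, rfl⟩ := hz
        rw [mem_openSegment_iff hν] at hm ⊢
        rw [ncoord_combo _ _ _ _ hab, tcoord_combo _ _ _ _ hab, ncoord_crossing,
          tcoord_crossing, hm.1]
        have ha0 : 0 < a := by
          refine lt_of_le_of_ne ha ?_
          rintro rfl
          rw [zero_add] at hab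
          subst hab
          simp at hzc
        refine ⟨by ring, ?_, ?_⟩
        · have := mul_pos ha0 hm.2.1
          linarith
        · nlinarith [hm.2.1, hm.2.2]
    · exact Set.disjoint_left.1 (M.primaryEdge_dualEdge e f hf.symm) hze hzf
  obtain ⟨ε, hε, hsub⟩ := hcpt.exists_thickening_subset_open hK.isOpen_compl hsub
  refine ⟨ε, hε, fun q hq hn ht i hqi => ?_⟩
  have hqK := hsub hq
  have key : ∀ f, q ∈ M.primaryEdge f ∪ M.dualEdge f → f = e := by
    intro f hf
    by_contra hfe
    exact hqK (mem_iUnion.2 ⟨⟨f, hfe⟩, hf⟩)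
  rcases mem_frontier_primaryCell.1 hqi with ⟨f, hf, hqf⟩ | ⟨f, hf, -, hqf⟩
  · obtain rfl := key f (Or.inl hqf)
    exact hn (ncoord_eq_zero_of_mem_primaryEdge hqf)
  · obtain rfl := key f (Or.inr (segment_subset_dualEdge hf hqf))
    rw [tcoord_eq_zero_of_mem_dualEdge (segment_subset_dualEdge hf hqf), zero_mul] at ht
    exact ht.false

theorem subset_interior_of_avoiding_frontier {s P : Set Plane} (hs : IsPreconnected s)
    (hf : ∀ q ∈ s, q ∉ frontier P) (hne : (s ∩ interior P).Nonempty) (hP : IsClosed P) :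
    s ⊆ interior P := by
  refine hs.subset_of_closure_inter_subset isOpen_interior hne ?_
  rintro q ⟨hq, hqs⟩
  by_contra hqi
  refine hf q hqs ?_
  rw [frontier, hP.closure_eq]
  exact ⟨closure_minimal interior_subset hP hq, hqi⟩

theorem convex_ncoord_pos (M : StaggeredMesh Ω I N E) (e : E) (c : ℝ) :
    Convex ℝ {q | 0 < M.ncoord e q * c} := by
  intro p hp q hq a b ha hb hab
  rw [mem_ofPred_eq] at *
  rw [ncoord_combo _ _ _ _ hab, add_mul, mul_assoc, mul_assoc]
  exact (convex_Ioi (0 : ℝ)) hp hq ha hb hab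

theorem convex_tcoord_pos (M : StaggeredMesh Ω I N E) (e : E) (c : ℝ) :
    Convex ℝ {q | 0 < M.tcoord e q * c} := by
  intro p hp q hq a b ha hb hab
  rw [mem_ofPred_eq] at *
  rw [tcoord_combo _ _ _ _ hab, add_mul, mul_assoc, mul_assoc]
  exact (convex_Ioi (0 : ℝ)) hp hq ha hb hab

/-- Near an inner point of a primary edge, the side of the edge that contains the centre `x_i`
belongs to the cell `A_i`. -/
theorem eventually_mem_interior_primaryCell [Finite E] (hν : ν ∈ M.VE e) (hi : i ∈ M.CE e)
    {m : Plane} (hm : m ∈ openSegment ℝ (M.dualCenter ν) (M.crossing e)) :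
    ∀ᶠ q in 𝓝 m, 0 < M.ncoord e q * M.ncoord e (M.primaryCenter i) →
      q ∈ interior (M.primaryCell i) := by
  obtain ⟨ε, hε, hav⟩ := exists_thickening_avoiding_frontier hν hm
  obtain ⟨j, hji, hCE⟩ := exists_CE_eq hi
  have hneg := ncoord_mul_neg_of_CE_eq hCE
  set T := Metric.thickening ε (segment ℝ m (M.crossing e)) with hT
  have hTo : IsOpen T := Metric.isOpen_thickening
  have hTc : Convex ℝ T := (convex_segment _ _).thickening ε
  have hto : IsOpen {q | 0 < M.tcoord e q * M.tcoord e (M.dualCenter ν)} :=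
    isOpen_lt continuous_const ((M.continuous_tcoord e).mul continuous_const)
  have hmt := ((mem_openSegment_iff hν).1 hm).2.1
  have hmU : T ∩ {q | 0 < M.tcoord e q * M.tcoord e (M.dualCenter ν)} ∈ 𝓝 m :=
    (hTo.inter hto).mem_nhds ⟨Metric.self_subset_thickening hε _ (left_mem_segment ℝ _ _), hmt⟩
  -- Each half of the neighbourhood, cut along the line of the edge, is convex and free of
  -- frontiers, so it lies in the interior of A_i as soon as it meets it.
  have hstrip : ∀ c : ℝ, ((T ∩ {q | 0 < M.tcoord e q * M.tcoord e (M.dualCenter ν)} ∩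
      {q | 0 < M.ncoord e q * c}) ∩ interior (M.primaryCell i)).Nonempty →
      T ∩ {q | 0 < M.tcoord e q * M.tcoord e (M.dualCenter ν)} ∩ {q | 0 < M.ncoord e q * c} ⊆
        interior (M.primaryCell i) := by
    intro c hne
    refine subset_interior_of_avoiding_frontier ?_ ?_ hne (isClosed_primaryCell M i)
    · exact ((hTc.inter (convex_tcoord_pos M e _)).inter (convex_ncoord_pos M e c)).isPreconnected
    · rintro q ⟨⟨h1, h2⟩, h3⟩
      refine hav q h1 ?_ h2 i
      intro h0
      rw [mem_ofPred_eq, h0, zero_mul] at h3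
      exact h3.false
  suffices hmain : T ∩ {q | 0 < M.tcoord e q * M.tcoord e (M.dualCenter ν)} ∩
      {q | 0 < M.ncoord e q * M.ncoord e (M.primaryCenter i)} ⊆ interior (M.primaryCell i) by
    filter_upwards [hmU] with q hq hqi
    exact hmain ⟨hq, hqi⟩
  -- Since A_i is the closure of its interior, interior points come arbitrarily near m, and one can
  -- be moved off the line of the edge.
  have hmcl : m ∈ closure (interior (M.primaryCell i)) := by
    rw [closure_interior_primaryCell]
    exact primaryEdge_subset_primaryCell hi (openSegment_subset_primaryEdge hν hm)
  obtain ⟨q, ⟨⟨hq1, hq2⟩, hqi⟩, hqn⟩ := (dense_inner_ne (M.normal_ne_zero e)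
    (M.crossing e)).inter_open_nonempty _ ((hTo.inter hto).inter isOpen_interior)
    (mem_closure_iff_nhds.1 hmcl _ hmU)
  have hqn : M.ncoord e q ≠ 0 := hqn
  have hni := ncoord_primaryCenter_ne_zero hi
  rcases lt_or_gt_of_ne (mul_ne_zero hqn hni) with hlt | hgt
  -- If that point is on the side of x_j, the interior of A_i spreads down the strip to the dual
  -- edge near y_e, then along the dual edge to x_j, which belongs to A_j.
  · exfalso
    have hqj : 0 < M.ncoord e q * M.ncoord e (M.primaryCenter j) := by
      have h3 : 0 < M.ncoord e (M.primaryCenter i) ^ 2 *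
          (M.ncoord e q * M.ncoord e (M.primaryCenter j)) := by
        nlinarith [mul_pos_of_neg_of_neg hlt hneg]
      exact pos_of_mul_pos_right h3 (sq_nonneg _)
    have hj : j ∈ M.CE e := (mem_CE_iff_of_eq hCE).2 (Or.inr rfl)
    have hnj := ncoord_primaryCenter_ne_zero hj
    have hbν := tcoord_dualCenter_ne_zero hν
    have hWj := hstrip _ ⟨q, ⟨⟨hq1, hq2⟩, hqj⟩, hqi⟩
    have hpos : ∀ z ∈ openSegment ℝ (M.crossing e) (M.primaryCenter j),
        z ∈ M.dualEdge e ∧ 0 < M.ncoord e z * M.ncoord e (M.primaryCenter j) := by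
      intro z hz
      refine ⟨(convex_convexHull ℝ _).openSegment_subset (M.crossing_mem_dual e)
        (primaryCenter_mem_dualEdge hj) hz, ?_⟩
      obtain ⟨a, b, ha, hb, hab, rfl⟩ := hz
      rw [ncoord_combo _ _ _ _ hab, ncoord_crossing]
      have : 0 < M.ncoord e (M.primaryCenter j) ^ 2 := by positivity
      nlinarith [mul_pos hb this]
    have hopen : openSegment ℝ (M.crossing e) (M.primaryCenter j) ⊆
        interior (M.primaryCell i) := by
      refine subset_interior_of_avoiding_frontier (convex_openSegment _ _).isPreconnected
        (fun z hz => notMem_frontier_primaryCell hCE (hpos z hz).1 (hpos z hz).2) ?_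
        (isClosed_primaryCell M i)
      have hlim : Tendsto (fun s : ℝ => (1 - s) • M.crossing e + s • M.primaryCenter j)
          (𝓝[>] 0) (𝓝 (M.crossing e)) := by
        have : Continuous fun s : ℝ => (1 - s) • M.crossing e + s • M.primaryCenter j := by
          fun_prop
        simpa using (this.tendsto 0).mono_left nhdsWithin_le_nhds
      have hyT : T ∈ 𝓝 (M.crossing e) :=
        hTo.mem_nhds (Metric.self_subset_thickening hε _ (right_mem_segment ℝ _ _))
      have hs1 : ∀ᶠ s : ℝ in 𝓝[>] 0, s < 1 :=
        nhdsWithin_le_nhds (Iio_mem_nhds one_pos)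
      obtain ⟨s, ⟨hsT, hs1⟩, hs0⟩ :=
        ((hlim.eventually hyT).and hs1 |>.and self_mem_nhdsWithin).exists
      set p := (1 - s) • M.crossing e + s • M.primaryCenter j with hp
      have hpo : p ∈ openSegment ℝ (M.crossing e) (M.primaryCenter j) :=
        ⟨1 - s, s, by linarith, hs0, by ring, rfl⟩
      refine ⟨p, hpo, ?_⟩
      -- The point p lies on the dual edge, the border of the strip; moving it slightly towards x_ν
      -- enters the strip, so p is a limit of points of A_i.
      have hpi : p ∈ M.primaryCell i := by
        have hlim2 : Tendsto (fun t : ℝ => (1 - t) • p + t • (M.dualCenter ν))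
            (𝓝[>] 0) (𝓝 p) := by
          have : Continuous fun t : ℝ => (1 - t) • p + t • (M.dualCenter ν) := by fun_prop
          simpa using (this.tendsto 0).mono_left nhdsWithin_le_nhds
        refine (isClosed_primaryCell M i).mem_of_tendsto hlim2 ?_
        filter_upwards [hlim2.eventually (hTo.mem_nhds hsT), self_mem_nhdsWithin,
          nhdsWithin_le_nhds (Iio_mem_nhds one_pos)] with t htT ht0 ht1
        rw [mem_Ioi] at ht0
        rw [mem_Iio] at ht1
        refine interior_subset (hWj ⟨⟨htT, ?_⟩, ?_⟩)
        · rw [mem_ofPred_eq, tcoord_combo _ _ _ _ (by ring),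
            tcoord_eq_zero_of_mem_dualEdge (hpos p hpo).1]
          have : 0 < M.tcoord e (M.dualCenter ν) ^ 2 := by positivity
          nlinarith [mul_pos ht0 this]
        · rw [mem_ofPred_eq, ncoord_combo _ _ _ _ (by ring), ncoord_dualCenter hν]
          nlinarith [mul_pos (sub_pos.2 ht1) (hpos p hpo).2]
      by_contra hpni
      refine notMem_frontier_primaryCell hCE (hpos p hpo).1 (hpos p hpo).2 ?_
      rw [frontier, (isClosed_primaryCell M i).closure_eq]
      exact ⟨hpi, hpni⟩
    have hxj : M.primaryCenter j ∈ M.primaryCell i := by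
      have h1 : M.primaryCenter j ∈
          closure (openSegment ℝ (M.crossing e) (M.primaryCenter j)) := by
        rw [closure_openSegment]
        exact right_mem_segment ℝ _ _
      exact closure_minimal (hopen.trans interior_subset) (isClosed_primaryCell M i) h1
    -- Being in A_i but in A_j as well, x_j cannot be interior to A_i, so it would be on the
    -- frontier.
    refine notMem_frontier_primaryCell hCE (primaryCenter_mem_dualEdge hj)
      (mul_self_pos.2 hnj) ?_
    rw [frontier, (isClosed_primaryCell M i).closure_eq]
    exact ⟨hxj, fun h => Set.disjoint_left.1 (disjoint_interior_primaryCell hji.symm) h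
      (M.primaryCenter_mem j)⟩
  · exact hstrip _ ⟨q, ⟨⟨hq1, hq2⟩, hgt⟩, hqi⟩

theorem interior_primaryCell_subset (M : StaggeredMesh Ω I N E) (hΩ : IsPolygonalDomain Ω)
    (i : I) : interior (M.primaryCell i) ⊆ Ω := by
  exact (interior_mono (subset_iUnion M.primaryCell i)).trans
    ((congrArg interior M.primaryCell_cover).trans hΩ.interior_closure).subset

theorem dualCenter_mem_domain (M : StaggeredMesh Ω I N E) (hΩ : IsPolygonalDomain Ω)
    (ν : N) : M.dualCenter ν ∈ Ω := by
  exact ((congrArg interior M.dualCell_cover).trans hΩ.interior_closure).subset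
    (interior_mono (subset_iUnion M.dualCell ν) (M.dualCenter_mem ν))

/-- Off the line of the edge, a neighbourhood of m is covered by the interiors of two cells, hence
lies in Ω. So the whole neighbourhood lies in the closure of Ω, whose interior is Ω. -/
theorem openSegment_subset_domain [Finite E] (hΩ : IsPolygonalDomain Ω) (hν : ν ∈ M.VE e) :
    openSegment ℝ (M.dualCenter ν) (M.crossing e) ⊆ Ω := by
  intro m hm
  obtain ⟨i, hi⟩ : (M.CE e).Nonempty := by
    rw [← Finset.card_pos, M.card_CE e]; norm_num
  obtain ⟨j, hji, hCE⟩ := exists_CE_eq hi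
  have hj : j ∈ M.CE e := (mem_CE_iff_of_eq hCE).2 (Or.inr rfl)
  have hneg := ncoord_mul_neg_of_CE_eq hCE
  obtain ⟨U, hU, hUo, hmU⟩ := eventually_nhds_iff.1
    ((eventually_mem_interior_primaryCell hν hi hm).and
      (eventually_mem_interior_primaryCell hν hj hm))
  rw [← hΩ.interior_closure]
  refine mem_interior.2 ⟨U, ?_, hUo, hmU⟩
  refine ((dense_inner_ne (M.normal_ne_zero e) (M.crossing e)).open_subset_closure_inter
    hUo).trans (closure_minimal ?_ isClosed_closure)
  rintro q ⟨hqU, hqn⟩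
  have hqn : M.ncoord e q ≠ 0 := hqn
  apply subset_closure
  rcases lt_or_gt_of_ne (mul_ne_zero hqn (ncoord_primaryCenter_ne_zero hi)) with h | h
  · refine interior_primaryCell_subset M hΩ j ((hU q hqU).2 ?_)
    have h3 : 0 < M.ncoord e (M.primaryCenter i) ^ 2 *
        (M.ncoord e q * M.ncoord e (M.primaryCenter j)) := by
      nlinarith [mul_pos_of_neg_of_neg h hneg]
    exact pos_of_mul_pos_right h3 (sq_nonneg _)
  · exact interior_primaryCell_subset M hΩ i ((hU q hqU).1 h)

theorem exists_mem_interior_primaryCell (hΩ : IsPolygonalDomain Ω) {q : Plane} (hq : q ∈ Ω)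
    (hqe : ∀ e, q ∉ M.primaryEdge e) : ∃ i, q ∈ interior (M.primaryCell i) := by
  have h := subset_closure hq
  rw [← M.primaryCell_cover] at h
  obtain ⟨i, hi⟩ := mem_iUnion.1 h
  refine ⟨i, ?_⟩
  by_contra hqi
  have hqf : q ∈ frontier (M.primaryCell i) := by
    rw [frontier, (isClosed_primaryCell M i).closure_eq]
    exact ⟨hi, hqi⟩
  rcases mem_frontier_primaryCell.1 hqf with ⟨f, -, hf⟩ | ⟨f, hif, hfΩ, hf⟩
  · exact hqe f hf
  · have := hfΩ (segment_subset_dualEdge hif hf)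
    rw [hΩ.isOpen.frontier_eq] at this
    exact this.2 hq

/-- Some edge f ends at x_ν because the dual cell has sides. If x_ν were on a foreign edge e, then e
and f would meet there and share that centre. -/
theorem dualCenter_mem_primaryEdge_iff : M.dualCenter ν ∈ M.primaryEdge e ↔ ν ∈ M.VE e := by
  refine ⟨fun h => ?_, fun h => subset_convexHull ℝ _ (mem_insert_of_mem _ ⟨ν, h, rfl⟩)⟩
  by_contra hν
  obtain ⟨n, c, -, hs⟩ := M.dualCell_polygon ν
  obtain ⟨f, hf, -⟩ := hs.superset ⟨0, rfl⟩
  have hfe : f ≠ e := by rintro rfl; exact hν hf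
  obtain ⟨μ, ⟨-, hμ⟩, heq⟩ := M.primaryEdge_inter f e hfe
    ⟨subset_convexHull ℝ _ (mem_insert_of_mem _ ⟨ν, hf, rfl⟩), h⟩
  exact hν (M.dualCenter_injective heq ▸ hμ)

end StaggeredMesh

/-! ### Logarithms with a cut along a segment -/

/-- The plane as the complex numbers. -/
def toComplex : Plane ≃ₗᵢ[ℝ] ℂ := Complex.orthonormalBasisOneI.repr.symm

theorem toComplex_apply (p : Plane) : toComplex p = p 0 + p 1 * Complex.I :=
  Complex.orthonormalBasisOneI_repr_symm_apply p

theorem toComplex_re (p : Plane) : (toComplex p).re = p 0 := by simp [toComplex_apply]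

theorem toComplex_im (p : Plane) : (toComplex p).im = p 1 := by simp [toComplex_apply]

/-- If b - z = -s (a - z) with s ≥ 0, then z = (s a + b)/(1 + s) is on the segment. -/
theorem div_mem_slitPlane {a b z : ℂ} (hz : z ∉ segment ℝ a b) :
    (b - z) / (a - z) ∈ Complex.slitPlane := by
  have ha : a - z ≠ 0 := fun h => hz (sub_eq_zero.1 h ▸ left_mem_segment ℝ a b)
  by_contra hcon
  rw [Complex.mem_slitPlane_iff, not_or, not_lt, not_not] at hcon
  set s := -((b - z) / (a - z)).re with hs
  have hs0 : 0 ≤ s := by linarith [hcon.1]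
  have h1 : (b - z) / (a - z) = ((-s : ℝ) : ℂ) := by
    apply Complex.ext
    · rw [Complex.ofReal_re, hs, neg_neg]
    · rw [Complex.ofReal_im, hcon.2]
  rw [div_eq_iff ha] at h1
  push_cast at h1
  have hs1 : (1 + s : ℂ) ≠ 0 := by
    have : (1 + s : ℝ) ≠ 0 := by positivity
    exact_mod_cast this
  refine hz ⟨s / (1 + s), 1 / (1 + s), by positivity, by positivity, by field_simp; ring, ?_⟩
  rw [Complex.real_smul, Complex.real_smul]
  push_cast
  field_simp
  linear_combination h1

theorem hasDerivAt_log_div {a b z : ℂ} (hz : z ∉ segment ℝ a b) :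
    HasDerivAt (fun z => Complex.log ((b - z) / (a - z))) ((z - b)⁻¹ - (z - a)⁻¹) z := by
  have ha : a - z ≠ 0 := fun h => hz (sub_eq_zero.1 h ▸ left_mem_segment ℝ a b)
  have hb : b - z ≠ 0 := fun h => hz (sub_eq_zero.1 h ▸ right_mem_segment ℝ a b)
  have ha' : z - a ≠ 0 := by rwa [← neg_sub, neg_ne_zero]
  have hb' : z - b ≠ 0 := by rwa [← neg_sub, neg_ne_zero]
  have h1 : HasDerivAt (fun z => (b - z) / (a - z))
      (((-1) * (a - z) - (b - z) * (-1)) / (a - z) ^ 2) z :=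
    ((hasDerivAt_id z).const_sub b).div ((hasDerivAt_id z).const_sub a) ha
  convert! h1.clog (div_mem_slitPlane hz) using 1
  rw [← neg_sub a z, ← neg_sub b z]
  field_simp

/-- The primitive is a continuous branch of log(z - y), which exists by simple connectedness and is
differentiable as a local inverse of exp. -/
theorem exists_hasDerivAt_inv_sub {U : Set ℂ} (hU : IsOpen U) (hsc : IsSimplyConnected U) {y : ℂ}
    (hy : y ∉ U) : ∃ L : ℂ → ℂ, ∀ z ∈ U, HasDerivAt L (z - y)⁻¹ z := by
  obtain ⟨L, hL, hexp⟩ := Complex.exists_continuousOn_eqOn_exp_comp hsc hU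
    (g := fun z => z - y) (by fun_prop) (by
      rintro ⟨z, hz, h⟩
      exact hy (sub_eq_zero.1 h ▸ hz))
  refine ⟨L, fun z hz => ?_⟩
  have hev : ∀ᶠ w in 𝓝 z, Complex.exp (L w) + y = w := by
    filter_upwards [hU.mem_nhds hz] with w hw
    have := hexp hw
    simp only [Function.comp_apply] at this
    rw [this]; ring
  have h := HasDerivAt.of_local_left_inverse (hL.continuousAt (hU.mem_nhds hz))
    ((Complex.hasDerivAt_exp (L z)).add_const y) (Complex.exp_ne_zero _) hev
  have h2 := hexp hz
  simp only [Function.comp_apply] at h2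
  rwa [h2] at h

theorem div_im_toComplex (a b : Plane) :
    (toComplex a / toComplex b).im = (b 0 * a 1 - b 1 * a 0) / ‖b‖ ^ 2 := by
  rw [Complex.div_im, toComplex_re, toComplex_re, toComplex_im, toComplex_im,
    Complex.normSq_eq_norm_sq, LinearIsometryEquiv.norm_map]
  ring

theorem toComplex_mem_segment_iff {a b z : Plane} :
    toComplex z ∈ segment ℝ (toComplex a) (toComplex b) ↔ z ∈ segment ℝ a b := by
  have := image_segment ℝ toComplex.toLinearEquiv.toLinearMap.toAffineMap a b
  constructor
  · intro h
    obtain ⟨w, hw, hwz⟩ := this.superset h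
    have : w = z := toComplex.injective hwz
    exact this ▸ hw
  · intro h
    exact this.subset ⟨z, h, rfl⟩

/-! ### Curl-free fields have a potential -/

namespace StaggeredMesh

variable {Ω : Set Plane} {I N E : Type*} {M : StaggeredMesh Ω I N E} {e f : E} {i j : I}
  {ν μ κ : N}

theorem segment_subset_primaryEdge (hν : ν ∈ M.VE e) :
    segment ℝ (M.dualCenter ν) (M.crossing e) ⊆ M.primaryEdge e :=
  (convex_convexHull ℝ _).segment_subset
    (subset_convexHull ℝ _ (mem_insert_of_mem _ ⟨ν, hν, rfl⟩))
    (crossing_mem_primaryEdge M e)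

theorem notMem_segment_of_mem_openSegment (hν : ν ∈ M.VE e) (hκ : κ ∈ M.VE f)
    (h : f = e → κ ≠ ν) {m : Plane} (hm : m ∈ openSegment ℝ (M.dualCenter ν) (M.crossing e)) :
    m ∉ segment ℝ (M.dualCenter κ) (M.crossing f) := by
  intro hmf
  by_cases hfe : f = e
  · subst hfe
    have hκν := h rfl
    have h1 := ((mem_openSegment_iff hν).1 hm).2.1
    rcases VE_cases hν with ⟨-, hVE⟩ | ⟨-, μ, hμ, hVE, hneg⟩
    · rw [← Finset.mem_coe, hVE] at hκ
      exact hκν hκ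
    · rw [← Finset.mem_coe, hVE] at hκ
      have : κ = μ := hκ.resolve_left hκν
      subst this
      obtain ⟨a, b, ha, hb, hab, rfl⟩ := hmf
      rw [tcoord_combo _ _ _ _ hab, tcoord_crossing] at h1
      nlinarith
  · exact notMem_primaryEdge_of_mem_openSegment hν hm hfe (segment_subset_primaryEdge hκ hmf)

theorem im_div_eq (hν : ν ∈ M.VE e) (q : Plane) :
    ((toComplex (M.crossing e) - toComplex q) / (toComplex (M.dualCenter ν) - toComplex q)).im =
      M.ncoord e q * M.tcoord e (M.dualCenter ν) / ‖M.dualCenter ν - q‖ ^ 2 := by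
  rw [← map_sub, ← map_sub, div_im_toComplex]
  congr 1
  have h := M.sub_crossing_eq e (M.dualCenter ν)
  rw [ncoord_dualCenter hν, zero_smul, zero_add] at h
  have h0 := congrArg (fun v : Plane => v 0) h
  have h1 := congrArg (fun v : Plane => v 1) h
  simp only [MeshData.tangent, PiLp.sub_apply, PiLp.smul_apply, rot_apply_zero, rot_apply_one,
    smul_eq_mul] at h0 h1
  rw [ncoord, inner_eq_coord]
  simp only [PiLp.sub_apply]
  linear_combination (M.crossing e 1 - q 1) * h0 - (M.crossing e 0 - q 0) * h1

theorem div_eq_neg_of_mem_openSegment {a b m : Plane} (hab : a ≠ b)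
    (hm : m ∈ openSegment ℝ a b) :
    ((toComplex b - toComplex m) / (toComplex a - toComplex m)).re < 0 ∧
    ((toComplex b - toComplex m) / (toComplex a - toComplex m)).im = 0 := by
  obtain ⟨s, t, hs, ht, hst, rfl⟩ := hm
  have hne : toComplex a - toComplex b ≠ 0 := sub_ne_zero.2 (toComplex.injective.ne hab)
  have h : (toComplex b - toComplex (s • a + t • b)) / (toComplex a - toComplex (s • a + t • b)) =
      ((-(s / t) : ℝ) : ℂ) := by
    have hst' : (s + t : ℂ) = 1 := by exact_mod_cast hst
    have ht' : (t : ℂ) ≠ 0 := by exact_mod_cast ht.ne'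
    have h1 : toComplex a - toComplex (s • a + t • b) = t * (toComplex a - toComplex b) := by
      rw [map_add, map_smul, map_smul, Complex.real_smul, Complex.real_smul]
      linear_combination (-toComplex a) * hst'
    have h2 : toComplex b - toComplex (s • a + t • b) = -s * (toComplex a - toComplex b) := by
      rw [map_add, map_smul, map_smul, Complex.real_smul, Complex.real_smul]
      linear_combination (-toComplex b) * hst'
    rw [h1, h2]
    push_cast
    field_simp
  rw [h, Complex.ofReal_re, Complex.ofReal_im]
  exact ⟨neg_lt_zero.2 (by positivity), rfl⟩

/-- On the half edge the quotient is a negative real, so only the sign of its imaginary part nearby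
matters. By `im_div_eq` this is the sign of a product of two coordinates, which on the side of x_i
is n_{e,i} t_{e,ν}. -/
theorem tendsto_log_side (hν : ν ∈ M.VE e) (hi : i ∈ M.CE e) {m : Plane}
    (hm : m ∈ openSegment ℝ (M.dualCenter ν) (M.crossing e)) :
    Tendsto (fun q => Complex.log ((toComplex (M.crossing e) - toComplex q) /
        (toComplex (M.dualCenter ν) - toComplex q)))
      (𝓝[{q | 0 < M.ncoord e q * M.ncoord e (M.primaryCenter i)}] m)
      (𝓝 (Real.log ‖(toComplex (M.crossing e) - toComplex m) /
        (toComplex (M.dualCenter ν) - toComplex m)‖ +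
        (M.nSign e i * M.tSign e ν : ℝ) * (Real.pi * Complex.I))) := by
  set g : Plane → ℂ := fun q => (toComplex (M.crossing e) - toComplex q) /
        (toComplex (M.dualCenter ν) - toComplex q) with hg
  obtain ⟨hre, him⟩ := div_eq_neg_of_mem_openSegment (M.crossing_ne_dualCenter e ν hν).symm hm
  have hden : toComplex (M.dualCenter ν) - toComplex m ≠ 0 := by
    intro h
    rw [h, div_zero] at hre
    simp at hre
  have hgc : ContinuousAt g m := by
    refine ContinuousAt.div ?_ ?_ hden
    · exact (continuous_const.sub toComplex.continuous).continuousAt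
    · exact (continuous_const.sub toComplex.continuous).continuousAt
  have hs := nSign_mul_ncoord_neg hi
  have ht := tSign_mul_tcoord_neg hν
  have hden2 : ∀ᶠ q in 𝓝 m, 0 < ‖M.dualCenter ν - q‖ ^ 2 := by
    have hmν : m ≠ M.dualCenter ν := by
      rintro rfl
      exact hden (sub_self _)
    filter_upwards [isOpen_ne.mem_nhds hmν] with q hq
    have := norm_pos_iff.2 (sub_ne_zero.2 (Ne.symm hq))
    positivity
  have himg : ∀ᶠ q in 𝓝[{q | 0 < M.ncoord e q * M.ncoord e (M.primaryCenter i)}] m,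
      0 < (M.nSign e i * M.tSign e ν) * (g q).im := by
    filter_upwards [self_mem_nhdsWithin, nhdsWithin_le_nhds hden2] with q hq hd
    rw [hg]
    simp only
    rw [im_div_eq hν, ← mul_div_assoc]
    refine div_pos ?_ hd
    have hn2 : 0 < M.ncoord e (M.primaryCenter i) ^ 2 := by
      have := ncoord_primaryCenter_ne_zero hi
      positivity
    have h3 : 0 < M.ncoord e (M.primaryCenter i) ^ 2 *
        (M.nSign e i * M.tSign e ν * (M.ncoord e q * M.tcoord e (M.dualCenter ν))) := by
      have := mul_pos (mul_pos_of_neg_of_neg hs ht) hq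
      linarith
    exact pos_of_mul_pos_right h3 hn2.le
  have hlim : Tendsto g (𝓝[{q | 0 < M.ncoord e q * M.ncoord e (M.primaryCenter i)}] m)
      (𝓝 (g m)) := hgc.tendsto.mono_left nhdsWithin_le_nhds
  have hcases : M.nSign e i * M.tSign e ν = 1 ∨ M.nSign e i * M.tSign e ν = -1 := by
    rcases nSign_eq_one_or M e i with h | h <;> rcases tSign_eq_one_or M e ν with h' | h' <;>
      simp [h, h']
  rcases hcases with h | h
  · rw [h] at himg ⊢
    have := (Complex.tendsto_log_nhdsWithin_im_nonneg_of_re_neg_of_im_zero hre him).comp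
      (tendsto_nhdsWithin_iff.2 ⟨hlim, himg.mono fun q hq => by
        rw [one_mul] at hq; exact hq.le⟩)
    simpa only [one_mul, Complex.ofReal_one, Function.comp_def] using this
  · rw [h] at himg ⊢
    have := (Complex.tendsto_log_nhdsWithin_im_neg_of_re_neg_of_im_zero hre him).comp
      (tendsto_nhdsWithin_iff.2 ⟨hlim, himg.mono fun q hq => by
        rw [neg_one_mul] at hq; exact neg_pos.1 hq⟩)
    simpa only [neg_one_mul, Complex.ofReal_neg, Complex.ofReal_one, ← sub_eq_add_neg,
      Function.comp_def] using this

theorem neBot_side (hi : i ∈ M.CE e) {m : Plane} (hm : M.ncoord e m = 0) :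
    (𝓝[{q | 0 < M.ncoord e q * M.ncoord e (M.primaryCenter i)}] m).NeBot := by
  rw [← mem_closure_iff_nhdsWithin_neBot]
  have hlim : Tendsto (fun s : ℝ => (1 - s) • m + s • M.primaryCenter i) (𝓝[>] 0) (𝓝 m) := by
    have : Continuous fun s : ℝ => (1 - s) • m + s • M.primaryCenter i := by fun_prop
    simpa using (this.tendsto 0).mono_left nhdsWithin_le_nhds
  refine mem_closure_of_tendsto hlim ?_
  filter_upwards [self_mem_nhdsWithin] with s hs
  have hs : 0 < s := hs
  rw [ncoord_combo _ _ _ _ (by ring), hm]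
  have : 0 < M.ncoord e (M.primaryCenter i) ^ 2 := by
    have := ncoord_primaryCenter_ne_zero hi
    positivity
  nlinarith [mul_pos hs this]

/-- This treats both ways of removing the pole at y_e at once: on the boundary D equals 1/(z - y_e),
and for an interior edge L = D = 0 and the signs t_{e,ν} add up to 0. -/
theorem exists_branch (M : StaggeredMesh Ω I N E) (hΩ : IsPolygonalDomain Ω)
    (hsc : IsSimplyConnected Ω) (e : E) : ∃ (L D : ℂ → ℂ), ∀ z ∈ toComplex '' Ω,
      HasDerivAt L (D z) z ∧
      ((z - toComplex (M.crossing e))⁻¹ - D z) * ∑ ν ∈ M.VE e, (M.tSign e ν : ℂ) = 0 := by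
  by_cases h : M.dualEdge e ⊆ frontier Ω
  · have hy : toComplex (M.crossing e) ∉ toComplex '' Ω := by
      rintro ⟨q, hq, hqe⟩
      rw [toComplex.injective hqe] at hq
      have := h (M.crossing_mem_dual e)
      rw [hΩ.isOpen.frontier_eq] at this
      exact this.2 hq
    obtain ⟨L, hL⟩ := exists_hasDerivAt_inv_sub
      (toComplex.toHomeomorph.isOpenMap _ hΩ.isOpen)
      (toComplex.toHomeomorph.isSimplyConnected_image.2 hsc) hy
    exact ⟨L, fun z => (z - toComplex (M.crossing e))⁻¹, fun z hz => ⟨hL z hz, by simp⟩⟩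
  · refine ⟨fun _ => 0, fun _ => 0, fun z _ => ⟨hasDerivAt_const z 0, ?_⟩⟩
    rw [← Complex.ofReal_sum, sum_tSign_eq_zero h]
    simp

theorem mem_EV [Fintype E] : e ∈ M.EV ν ↔ ν ∈ M.VE e := by
  simp [MeshData.EV]

theorem exists_potential [Fintype N] [Fintype E] (M : StaggeredMesh Ω I N E)
    (hΩ : IsPolygonalDomain Ω) (hsc : IsSimplyConnected Ω) (w : E → ℝ)
    (hw : ∀ ν, ∑ e ∈ M.EV ν, w e * M.tSign e ν = 0) :
    ∃ φ : I → ℝ, ∀ e, ∑ i ∈ M.CE e, φ i * M.nSign e i = -w e := by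
  classical
  choose L D hLD using exists_branch M hΩ hsc
  let S : Finset (Σ _ : E, N) := Finset.univ.sigma M.VE
  let term : (Σ _ : E, N) → ℂ → ℂ := fun p z => ((w p.1 * M.tSign p.1 p.2 : ℝ) : ℂ) *
    (Complex.log ((toComplex (M.crossing p.1) - z) / (toComplex (M.dualCenter p.2) - z)) -
      L p.1 z)
  let F : ℂ → ℂ := fun z => ∑ p ∈ S, term p z
  have hS : ∀ p, p ∈ S ↔ p.2 ∈ M.VE p.1 := fun p => by simp [S]
  have hderiv : ∀ p : (Σ _ : E, N), ∀ q ∈ Ω,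
      q ∉ segment ℝ (M.dualCenter p.2) (M.crossing p.1) →
      HasDerivAt (term p) (((w p.1 * M.tSign p.1 p.2 : ℝ) : ℂ) *
        ((toComplex q - toComplex (M.crossing p.1))⁻¹ -
          (toComplex q - toComplex (M.dualCenter p.2))⁻¹ - D p.1 (toComplex q)))
        (toComplex q) := by
    intro p q hq hqs
    exact ((hasDerivAt_log_div (fun h => hqs (toComplex_mem_segment_iff.1 h))).sub
      (hLD p.1 _ ⟨q, hq, rfl⟩).1).const_mul _
  have hF : ∀ i, ∀ q ∈ interior (M.primaryCell i), HasDerivAt F 0 (toComplex q) := by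
    intro i q hq
    have hqΩ := interior_primaryCell_subset M hΩ i hq
    have h := HasDerivAt.fun_sum fun p (hp : p ∈ S) => hderiv p q hqΩ fun hqs =>
      Set.disjoint_left.1 (disjoint_interior_primaryCell_primaryEdge M i p.1) hq
        (segment_subset_primaryEdge ((hS p).1 hp) hqs)
    convert! h using 1
    symm
    set z := toComplex q
    rw [Finset.sum_sigma]
    have h1 : ∀ e, ∑ ν ∈ M.VE e, ((w e * M.tSign e ν : ℝ) : ℂ) *
        ((z - toComplex (M.crossing e))⁻¹ - (z - toComplex (M.dualCenter ν))⁻¹ - D e z) =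
        -∑ ν ∈ M.VE e, ((w e * M.tSign e ν : ℝ) : ℂ) * (z - toComplex (M.dualCenter ν))⁻¹ := by
      intro e
      have h2 := (hLD e z ⟨q, hqΩ, rfl⟩).2
      rw [eq_neg_iff_add_eq_zero, ← Finset.sum_add_distrib]
      rw [Finset.mul_sum] at h2
      calc _ = ∑ ν ∈ M.VE e, (w e : ℂ) *
            (((z - toComplex (M.crossing e))⁻¹ - D e z) * (M.tSign e ν : ℂ)) := by
            refine Finset.sum_congr rfl fun ν _ => ?_
            push_cast
            ring
        _ = 0 := by rw [← Finset.mul_sum, h2, mul_zero]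
    -- What remains are the poles at the x_ν; collecting them by ν exposes the discrete curl as
    -- their coefficient.
    rw [Finset.sum_congr rfl fun e _ => h1 e, Finset.sum_neg_distrib, neg_eq_zero,
      Finset.sum_comm' (t' := Finset.univ) (s' := M.EV) (by simp [mem_EV])]
    refine Finset.sum_eq_zero fun ν _ => ?_
    rw [← Finset.sum_mul, ← Complex.ofReal_sum, hw ν]
    simp
  have hC : ∀ i, ∃ C : ℂ, ∀ q ∈ interior (M.primaryCell i), F (toComplex q) = C := by
    intro i
    obtain ⟨C, hC⟩ := (toComplex.toHomeomorph.isOpenMap _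
        (isOpen_interior (s := M.primaryCell i))).exists_is_const_of_deriv_eq_zero (f := F)
      ((isConnected_interior_primaryCell M i).isPreconnected.image _
        toComplex.continuous.continuousOn)
      (by
        rintro _ ⟨q, hq, rfl⟩
        exact (hF i q hq).differentiableAt.differentiableWithinAt)
      (by
        rintro _ ⟨q, hq, rfl⟩
        exact (hF i q hq).deriv)
    exact ⟨C, fun q hq => hC _ ⟨q, hq, rfl⟩⟩
  choose C hC using hC
  -- At one point m of a half edge only one logarithm is discontinuous. Comparing the limits of F
  -- from the two sides, R is the common part and the rest is ±πi times the weight.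
  have hjump : ∀ e, ∃ R : ℂ, ∀ i ∈ M.CE e,
      C i = R + ((w e * M.nSign e i : ℝ) : ℂ) * (Real.pi * Complex.I) := by
    intro e
    obtain ⟨ν, hν⟩ := M.VE_nonempty e
    obtain ⟨m, hm⟩ : (openSegment ℝ (M.dualCenter ν) (M.crossing e)).Nonempty :=
      ⟨_, 1 / 2, 1 / 2, by norm_num, by norm_num, by norm_num, rfl⟩
    have hmΩ := openSegment_subset_domain hΩ hν hm
    have hmn := ((mem_openSegment_iff hν).1 hm).1
    let p₀ : (Σ _ : E, N) := ⟨e, ν⟩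
    have hp₀ : p₀ ∈ S := (hS p₀).2 hν
    let G : ℂ → ℂ := fun z => (∑ p ∈ S.erase p₀, term p z) -
      ((w e * M.tSign e ν : ℝ) : ℂ) * L e z
    have hG : ContinuousAt G (toComplex m) := by
      refine ContinuousAt.sub (tendsto_finsetSum _ fun p hp => ?_)
        (continuousAt_const.mul (hLD e _ ⟨m, hmΩ, rfl⟩).1.continuousAt)
      obtain ⟨hp1, hp2⟩ := Finset.mem_erase.1 hp
      refine (hderiv p m hmΩ
        (notMem_segment_of_mem_openSegment hν ((hS p).1 hp2) ?_ hm)).continuousAt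
      rintro rfl rfl
      exact hp1 rfl
    have hFG : ∀ z, F z = G z + ((w e * M.tSign e ν : ℝ) : ℂ) *
        Complex.log ((toComplex (M.crossing e) - z) / (toComplex (M.dualCenter ν) - z)) := by
      intro z
      simp only [F, G]
      rw [← Finset.sum_erase_add _ _ hp₀]
      simp only [term, p₀]
      ring
    refine ⟨G (toComplex m) + ((w e * M.tSign e ν : ℝ) : ℂ) *
      (Real.log ‖(toComplex (M.crossing e) - toComplex m) /
        (toComplex (M.dualCenter ν) - toComplex m)‖ : ℝ), fun i hi => ?_⟩
    have := neBot_side hi hmn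
    have hlim1 : Tendsto (fun q => F (toComplex q))
        (𝓝[{q | 0 < M.ncoord e q * M.ncoord e (M.primaryCenter i)}] m) (𝓝 (C i)) := by
      refine tendsto_const_nhds.congr' ?_
      filter_upwards [self_mem_nhdsWithin,
        nhdsWithin_le_nhds (eventually_mem_interior_primaryCell hν hi hm)] with q h1 h2
      exact (hC i q (h2 h1)).symm
    have hlim2 := ((hG.tendsto.comp toComplex.continuous.continuousAt).mono_left
      (nhdsWithin_le_nhds (s := {q | 0 < M.ncoord e q * M.ncoord e (M.primaryCenter i)}))).add
      ((tendsto_log_side hν hi hm).const_mul ((w e * M.tSign e ν : ℝ) : ℂ))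
    have heq := tendsto_nhds_unique hlim1 (hlim2.congr fun q => (hFG _).symm)
    rw [heq]
    have ht : (M.tSign e ν : ℂ) * M.tSign e ν = 1 := by
      rcases tSign_eq_one_or M e ν with h | h <;> simp [h]
    push_cast
    linear_combination (w e * M.nSign e i * Real.pi * Complex.I : ℂ) * ht
  -- The factor 1/(2π) normalises the jump 2πi, and the minus sign matches the right-hand side -w_e.
  refine ⟨fun i => -(C i).im / (2 * Real.pi), fun e => ?_⟩
  obtain ⟨R, hR⟩ := hjump e
  obtain ⟨i, hi⟩ : (M.CE e).Nonempty := by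
    rw [← Finset.card_pos, M.card_CE e]; norm_num
  obtain ⟨j, hji, hCE⟩ := exists_CE_eq hi
  have hj : j ∈ M.CE e := (mem_CE_iff_of_eq hCE).2 (Or.inr rfl)
  have hCE' : M.CE e = {i, j} := by ext; rw [mem_CE_iff_of_eq hCE]; simp
  rw [hCE', Finset.sum_pair hji.symm]
  simp only
  rw [hR i hi, hR j hj, nSign_eq_neg_of_CE_eq hCE]
  have hn : M.nSign e i * M.nSign e i = 1 := by
    rcases nSign_eq_one_or M e i with h | h <;> simp [h]
  have him : ∀ c : ℝ, (R + (c : ℂ) * (Real.pi * Complex.I)).im = R.im + c * Real.pi := by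
    intro c; simp
  rw [him, him]
  have := Real.pi_ne_zero
  field_simp
  linear_combination (-2 * w e * Real.pi) * hn

end StaggeredMesh

/-! ### Jumps around a dual centre -/

/-- The punctured limit values C(θ₀) form a locally constant, hence constant, function on the line,
so K cannot gain S over a translation by T. Punctured neighbourhoods make the values of K at the
jump angles irrelevant. -/
theorem eq_zero_of_eventually_const {K : ℝ → ℝ} {S T : ℝ}
    (hK : ∀ θ₀, ∃ C, ∀ᶠ θ in 𝓝[≠] θ₀, K θ = C) (hS : ∀ θ, K (θ + T) = K θ + S) : S = 0 := by
  choose C hC using hK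
  have hloc : IsLocallyConstant C := by
    rw [IsLocallyConstant.iff_eventually_eq]
    intro θ₀
    have h := eventually_nhdsWithin_iff.1 (hC θ₀)
    filter_upwards [h.eventually_nhds] with y hy
    by_cases hyθ : y = θ₀
    · rw [hyθ]
    · obtain ⟨θ, ⟨h1, h2⟩, h3⟩ := ((hC y).and (nhdsWithin_le_nhds hy) |>.and
        (nhdsWithin_le_nhds (isOpen_ne.mem_nhds hyθ))).exists
      rw [← h1]
      exact h2 h3
  have h0T : C T = C 0 := hloc.apply_eq_of_preconnectedSpace T 0
  have hT : Tendsto (fun θ : ℝ => θ + T) (𝓝[≠] 0) (𝓝[≠] T) := by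
    refine tendsto_nhdsWithin_iff.2 ⟨?_, ?_⟩
    · have : Continuous fun θ : ℝ => θ + T := by fun_prop
      simpa using (this.tendsto 0).mono_left nhdsWithin_le_nhds
    · filter_upwards [self_mem_nhdsWithin] with θ hθ h
      exact hθ (by simpa using h)
  obtain ⟨θ, h1, h2⟩ := ((hC 0).and (hT.eventually (hC T))).exists
  have := hS θ
  rw [h1, h2, h0T] at this
  linarith

theorem eventually_floor_eq {x₀ : ℝ} (h : ∀ k : ℤ, x₀ ≠ k) : ∀ᶠ x in 𝓝 x₀, ⌊x⌋ = ⌊x₀⌋ := by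
  have h1 : (⌊x₀⌋ : ℝ) < x₀ := lt_of_le_of_ne (Int.floor_le _) (h _).symm
  filter_upwards [Ioo_mem_nhds h1 (Int.lt_floor_add_one x₀)] with x hx
  exact Int.floor_eq_iff.2 ⟨hx.1.le, hx.2⟩

/-- The unit vector with angle `θ`. -/
def circleVec (θ : ℝ) : Plane := !₂[Real.cos θ, Real.sin θ]

theorem continuous_circleVec : Continuous circleVec := by
  refine (PiLp.continuous_toLp 2 _).comp (continuous_pi fun k => ?_)
  fin_cases k
  · exact Real.continuous_cos
  · exact Real.continuous_sin

theorem norm_circleVec (θ : ℝ) : ‖circleVec θ‖ = 1 := by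
  rw [← sq_eq_sq₀ (norm_nonneg _) zero_le_one, norm_sq_eq_coord]
  simp [circleVec]

theorem circleVec_add_two_pi (θ : ℝ) : circleVec (θ + 2 * Real.pi) = circleVec θ := by
  simp [circleVec]

theorem eq_norm_smul_circleVec (v : Plane) :
    v = ‖v‖ • circleVec (Complex.arg (toComplex v)) := by
  have h : ‖toComplex v‖ = ‖v‖ := toComplex.norm_map v
  ext k
  fin_cases k
  · have := Complex.norm_mul_cos_arg (toComplex v)
    rw [h, toComplex_re] at this
    exact this.symm
  · have := Complex.norm_mul_sin_arg (toComplex v)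
    rw [h, toComplex_im] at this
    exact this.symm

namespace StaggeredMesh

variable {Ω : Set Plane} {I N E : Type*} {M : StaggeredMesh Ω I N E} {e f : E} {i j : I}
  {ν μ κ : N}

theorem primaryField_apply [Fintype I] (φ : I → ℝ) {q : Plane}
    (hq : q ∈ interior (M.primaryCell i)) : M.primaryField φ q = φ i := by
  change ∑ j, φ j • (interior (M.primaryCell j)).indicator (fun _ => (1 : ℝ)) q = _
  rw [Finset.sum_eq_single i]
  · rw [indicator_of_mem hq]; simp
  · intro j _ hj
    rw [indicator_of_notMem, smul_zero]
    exact fun hqj => Set.disjoint_left.1 (M.primaryCell_disjoint j i hj) hqj hq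
  · simp

/-- The direction of the primary edge `e` as seen from the centre `x_ν`. -/
def edgeAngle (M : StaggeredMesh Ω I N E) (ν : N) (e : E) : ℝ :=
  Complex.arg (toComplex (M.crossing e - M.dualCenter ν))

theorem tangent_eq (hν : ν ∈ M.VE e) :
    M.tangent e = M.tSign e ν • circleVec (M.edgeAngle ν e) ∧
    M.tcoord e (M.dualCenter ν) = -(M.tSign e ν * ‖M.crossing e - M.dualCenter ν‖) := by
  have h := M.sub_crossing_eq e (M.dualCenter ν)
  rw [ncoord_dualCenter hν, zero_smul, zero_add] at h
  have hρ : 0 < ‖M.crossing e - M.dualCenter ν‖ :=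
    norm_pos_iff.2 (sub_ne_zero.2 (M.crossing_ne_dualCenter e ν hν))
  have habs : ‖M.crossing e - M.dualCenter ν‖ = |M.tcoord e (M.dualCenter ν)| := by
    rw [norm_sub_rev, h, norm_smul, M.norm_tangent, mul_one, Real.norm_eq_abs]
  have htt : M.tSign e ν * M.tSign e ν = 1 := by
    rcases tSign_eq_one_or M e ν with h | h <;> simp [h]
  have hb : M.tcoord e (M.dualCenter ν) = -(M.tSign e ν * ‖M.crossing e - M.dualCenter ν‖) := by
    have ht := tSign_mul_tcoord_neg hν
    rcases tSign_eq_one_or M e ν with h1 | h1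
    · rw [h1] at ht ⊢
      rw [habs, abs_of_neg (by linarith)]; ring
    · rw [h1] at ht ⊢
      rw [habs, abs_of_pos (by linarith)]; ring
  refine ⟨?_, hb⟩
  have hv : M.crossing e - M.dualCenter ν =
      ‖M.crossing e - M.dualCenter ν‖ • M.tSign e ν • M.tangent e := by
    conv_lhs => rw [← neg_sub, h, hb, neg_smul, neg_neg, mul_comm, mul_smul]
  have h2 := hv.symm.trans (eq_norm_smul_circleVec (M.crossing e - M.dualCenter ν))
  have h3 := smul_right_injective Plane hρ.ne' h2
  rw [edgeAngle, ← h3, smul_smul, htt, one_smul]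

theorem ncoord_circle (hν : ν ∈ M.VE e) (r θ : ℝ) :
    M.ncoord e (M.dualCenter ν + r • circleVec θ) =
      -(M.tSign e ν * r * Real.sin (θ - M.edgeAngle ν e)) := by
  have h := (tangent_eq hν).1
  have h0 : -(M.normal e 1) = M.tSign e ν * Real.cos (M.edgeAngle ν e) := by
    simpa [MeshData.tangent, circleVec] using congrArg (fun v : Plane => v 0) h
  have h1 : M.normal e 0 = M.tSign e ν * Real.sin (M.edgeAngle ν e) := by
    simpa [MeshData.tangent, circleVec] using congrArg (fun v : Plane => v 1) h
  have hc := ncoord_dualCenter hν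
  rw [ncoord] at hc ⊢
  rw [add_sub_right_comm, inner_add_right, hc, inner_smul_right, inner_eq_coord, Real.sin_sub]
  simp only [circleVec, PiLp.toLp_apply, Matrix.cons_val_zero, Matrix.cons_val_one]
  linear_combination r * Real.cos θ * h1 - r * Real.sin θ * h0

theorem tcoord_circle (hν : ν ∈ M.VE e) (r θ : ℝ) :
    M.tcoord e (M.dualCenter ν + r • circleVec θ) =
      -(M.tSign e ν * (‖M.crossing e - M.dualCenter ν‖ - r * Real.cos (θ - M.edgeAngle ν e))) := by
  obtain ⟨h, hc⟩ := tangent_eq hν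
  rw [tcoord] at hc ⊢
  rw [add_sub_right_comm, inner_add_right, hc, inner_smul_right, h, inner_smul_left,
    inner_eq_coord, Real.cos_sub]
  simp [circleVec]
  ring

/-- Lying on the line of the edge gives sin = 0; not lying beyond x_ν gives cos ≥ 0, so the angle is
that of the edge and not its opposite. -/
theorem circle_mem_primaryEdge (hν : ν ∈ M.VE e) {r θ : ℝ} (hr : 0 < r)
    (h : M.dualCenter ν + r • circleVec θ ∈ M.primaryEdge e) :
    ∃ k : ℤ, θ - M.edgeAngle ν e = k * (2 * Real.pi) := by
  have h1 := ncoord_eq_zero_of_mem_primaryEdge h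
  have h2 := tcoord_mul_le_of_mem_primaryEdge h hν
  have hρ : 0 < ‖M.crossing e - M.dualCenter ν‖ :=
    norm_pos_iff.2 (sub_ne_zero.2 (M.crossing_ne_dualCenter e ν hν))
  have htt : M.tSign e ν * M.tSign e ν = 1 := by
    rcases tSign_eq_one_or M e ν with h | h <;> simp [h]
  have ht0 : M.tSign e ν ≠ 0 := by rintro h; simp [h] at htt
  rw [ncoord_circle hν, neg_eq_zero] at h1
  have hsin := (mul_eq_zero.1 h1).resolve_left (mul_ne_zero ht0 hr.ne')
  rw [tcoord_circle hν, (tangent_eq hν).2] at h2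
  have h3 : 0 ≤ r * ‖M.crossing e - M.dualCenter ν‖ * Real.cos (θ - M.edgeAngle ν e) := by
    set ρ := ‖M.crossing e - M.dualCenter ν‖
    set c := Real.cos (θ - M.edgeAngle ν e)
    have e1 : -(M.tSign e ν * (ρ - r * c)) * -(M.tSign e ν * ρ) = (ρ - r * c) * ρ := by
      linear_combination (ρ - r * c) * ρ * htt
    have e2 : (-(M.tSign e ν * ρ)) ^ 2 = ρ ^ 2 := by linear_combination ρ ^ 2 * htt
    rw [e1, e2] at h2
    linarith
  have hcos := nonneg_of_mul_nonneg_right h3 (mul_pos hr hρ)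
  have hcos1 : Real.cos (θ - M.edgeAngle ν e) = 1 := by
    rcases Real.sin_eq_zero_iff_cos_eq.1 hsin with h | h
    · exact h
    · linarith
  obtain ⟨k, hk⟩ := (Real.cos_eq_one_iff _).1 hcos1
  exact ⟨k, hk.symm⟩

theorem circle_mem_openSegment (hν : ν ∈ M.VE e) {r θ : ℝ} (hr : 0 < r)
    (hrρ : r < ‖M.crossing e - M.dualCenter ν‖) {k : ℤ}
    (h : θ - M.edgeAngle ν e = k * (2 * Real.pi)) :
    M.dualCenter ν + r • circleVec θ ∈ openSegment ℝ (M.dualCenter ν) (M.crossing e) := by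
  have hcos : Real.cos (θ - M.edgeAngle ν e) = 1 := by rw [h, Real.cos_int_mul_two_pi]
  have hsin : Real.sin (θ - M.edgeAngle ν e) = 0 := by
    rw [h, show (k : ℝ) * (2 * Real.pi) = ((2 * k : ℤ) : ℝ) * Real.pi by push_cast; ring,
      Real.sin_int_mul_pi]
  have htt : M.tSign e ν * M.tSign e ν = 1 := by
    rcases tSign_eq_one_or M e ν with h | h <;> simp [h]
  rw [mem_openSegment_iff hν, ncoord_circle hν, tcoord_circle hν, (tangent_eq hν).2, hcos, hsin]
  set ρ := ‖M.crossing e - M.dualCenter ν‖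
  have e1 : -(M.tSign e ν * (ρ - r * 1)) * -(M.tSign e ν * ρ) = (ρ - r) * ρ := by
    linear_combination (ρ - r) * ρ * htt
  have e2 : (-(M.tSign e ν * ρ)) ^ 2 = ρ ^ 2 := by linear_combination ρ ^ 2 * htt
  rw [e1, e2]
  refine ⟨by ring, mul_pos (by linarith) (by linarith), by nlinarith⟩

theorem exists_radius [Finite E] (hΩ : IsPolygonalDomain Ω) (M : StaggeredMesh Ω I N E) (ν : N) :
    ∃ r > 0, (∀ θ, M.dualCenter ν + r • circleVec θ ∈ Ω) ∧
      (∀ θ e, ν ∉ M.VE e → M.dualCenter ν + r • circleVec θ ∉ M.primaryEdge e) ∧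
      ∀ e, ν ∈ M.VE e → r < ‖M.crossing e - M.dualCenter ν‖ := by
  have h1 : ∀ᶠ q in 𝓝 (M.dualCenter ν), q ∈ Ω :=
    hΩ.isOpen.mem_nhds (dualCenter_mem_domain M hΩ ν)
  have h2 : ∀ᶠ q in 𝓝 (M.dualCenter ν), ∀ e, ν ∉ M.VE e → q ∉ M.primaryEdge e := by
    refine eventually_all.2 fun e => ?_
    by_cases he : ν ∈ M.VE e
    · exact Eventually.of_forall fun q h => absurd he h
    · filter_upwards [(primaryEdge_closed M e).isOpen_compl.mem_nhds
        (fun h => he (dualCenter_mem_primaryEdge_iff.1 h))] with q hq _ using hq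
  have h3 : ∀ᶠ q in 𝓝 (M.dualCenter ν), ∀ e, ν ∈ M.VE e →
      ‖q - M.dualCenter ν‖ < ‖M.crossing e - M.dualCenter ν‖ := by
    refine eventually_all.2 fun e => ?_
    by_cases he : ν ∈ M.VE e
    · have hc : Continuous fun q => ‖q - M.dualCenter ν‖ := by fun_prop
      have hρ : 0 < ‖M.crossing e - M.dualCenter ν‖ :=
        norm_pos_iff.2 (sub_ne_zero.2 (M.crossing_ne_dualCenter e ν he))
      have := (hc.tendsto (M.dualCenter ν)).eventually_lt_const (v := _) 
        (by rwa [sub_self, norm_zero])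
      filter_upwards [this] with q hq _ using hq
    · exact Eventually.of_forall fun q h => absurd h he
  obtain ⟨ε, hε, hball⟩ := Metric.eventually_nhds_iff.1 (h1.and (h2.and h3))
  have hdist : ∀ θ, ‖M.dualCenter ν + (ε / 2) • circleVec θ - M.dualCenter ν‖ = ε / 2 := by
    intro θ
    rw [add_sub_cancel_left, norm_smul, norm_circleVec, mul_one, Real.norm_eq_abs,
      abs_of_pos (by positivity)]
  have hmem : ∀ θ, dist (M.dualCenter ν + (ε / 2) • circleVec θ) (M.dualCenter ν) < ε := by
    intro θ
    rw [dist_eq_norm, hdist]; linarith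
  refine ⟨ε / 2, by positivity, fun θ => (hball (hmem θ)).1,
    fun θ e he => (hball (hmem θ)).2.1 e he, fun e he => ?_⟩
  have := (hball (hmem 0)).2.2 e he
  rwa [hdist] at this

/-- Subtracting from φ_h on the circle a multiple c_e of an integer-valued staircase for each edge
removes all jumps, while one turn changes the result by -Σ c_e. `eq_zero_of_eventually_const` then
makes this total vanish. -/
theorem sum_jump_eq_zero [Fintype I] [Fintype E] (hΩ : IsPolygonalDomain Ω)
    (M : StaggeredMesh Ω I N E) (φ : I → ℝ) (ν : N) :
    ∑ e ∈ M.EV ν, (∑ i ∈ M.CE e, φ i * M.nSign e i) * M.tSign e ν = 0 := by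
  classical
  obtain ⟨r, hr, hrΩ, hrf, hrρ⟩ := exists_radius hΩ M ν
  let γ : ℝ → Plane := fun θ => M.dualCenter ν + r • circleVec θ
  have hγ : Continuous γ := continuous_const.add (continuous_circleVec.const_smul r)
  let c : E → ℝ := fun e => (∑ i ∈ M.CE e, φ i * M.nSign e i) * M.tSign e ν
  let x : E → ℝ → ℝ := fun e θ => (θ - M.edgeAngle ν e) / (2 * Real.pi)
  have hx : ∀ e, Continuous (x e) := fun e => by fun_prop
  have hπ : 0 < 2 * Real.pi := Real.two_pi_pos
  have hxk : ∀ e θ (k : ℤ), x e θ = k ↔ θ - M.edgeAngle ν e = k * (2 * Real.pi) :=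
    fun e θ k => div_eq_iff hπ.ne'
  -- The floor of x_e rises by one exactly when the circle crosses the edge e counterclockwise.
  let K : ℝ → ℝ := fun θ => M.primaryField φ (γ θ) - ∑ e ∈ M.EV ν, c e * ⌊x e θ⌋
  suffices h : -∑ e ∈ M.EV ν, c e = 0 from neg_eq_zero.1 h
  refine eq_zero_of_eventually_const (K := K) (T := 2 * Real.pi) (fun θ₀ => ?_) (fun θ => ?_)
  · by_cases hB : ∃ e ∈ M.EV ν, γ θ₀ ∈ M.primaryEdge e
    · obtain ⟨e, he, hmem⟩ := hB
      have hν := mem_EV.1 he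
      obtain ⟨k, hk⟩ := circle_mem_primaryEdge hν hr hmem
      have hseg : γ θ₀ ∈ openSegment ℝ (M.dualCenter ν) (M.crossing e) :=
        circle_mem_openSegment hν hr (hrρ e hν) hk
      have hrest : ∀ᶠ θ in 𝓝 θ₀, ∑ f ∈ (M.EV ν).erase e, c f * (⌊x f θ⌋ : ℝ) =
          ∑ f ∈ (M.EV ν).erase e, c f * (⌊x f θ₀⌋ : ℝ) := by
        have : ∀ᶠ θ in 𝓝 θ₀, ∀ f ∈ (M.EV ν).erase e, ⌊x f θ⌋ = ⌊x f θ₀⌋ := by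
          rw [Filter.eventually_all_finset]
          intro f hf
          obtain ⟨hfe, hfν⟩ := Finset.mem_erase.1 hf
          refine ((hx f).tendsto θ₀).eventually (eventually_floor_eq fun l hl => ?_)
          have hfν := mem_EV.1 hfν
          exact notMem_primaryEdge_of_mem_openSegment hν hseg hfe
            (openSegment_subset_primaryEdge hfν
              (circle_mem_openSegment hfν hr (hrρ f hfν) ((hxk f θ₀ l).1 hl)))
        filter_upwards [this] with θ hθ
        exact Finset.sum_congr rfl fun f hf => by rw [hθ f hf]
      obtain ⟨a, ha⟩ : (M.CE e).Nonempty := by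
        rw [← Finset.card_pos, M.card_CE e]; norm_num
      have htt : M.tSign e ν * M.tSign e ν = 1 := by
        rcases tSign_eq_one_or M e ν with h | h <;> simp [h]
      -- Naming the cells so that n_{e,i} = t_{e,ν} makes A_i the cell entered and A_j the one left
      -- in counterclockwise motion.
      obtain ⟨i, j, hji, hCE, hnt⟩ : ∃ i j, j ≠ i ∧ (M.CE e : Set I) = {i, j} ∧
          M.nSign e i = M.tSign e ν := by
        obtain ⟨b, hba, hCE⟩ := exists_CE_eq ha
        have hb := nSign_eq_neg_of_CE_eq hCE
        rcases nSign_eq_one_or M e a with h1 | h1 <;> rcases tSign_eq_one_or M e ν with h2 | h2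
        · exact ⟨a, b, hba, hCE, by rw [h1, h2]⟩
        · exact ⟨b, a, hba.symm, by rw [hCE, Set.pair_comm], by rw [hb, h1, h2]⟩
        · exact ⟨b, a, hba.symm, by rw [hCE, Set.pair_comm], by rw [hb, h1, h2, neg_neg]⟩
        · exact ⟨a, b, hba, hCE, by rw [h1, h2]⟩
      have hi : i ∈ M.CE e := (mem_CE_iff_of_eq hCE).2 (Or.inl rfl)
      have hj : j ∈ M.CE e := (mem_CE_iff_of_eq hCE).2 (Or.inr rfl)
      have hce : c e = φ i - φ j := by
        have hCE' : M.CE e = {i, j} := by ext; rw [mem_CE_iff_of_eq hCE]; simp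
        simp only [c]
        rw [hCE', Finset.sum_pair hji.symm, nSign_eq_neg_of_CE_eq hCE, hnt]
        linear_combination (φ i - φ j) * htt
      have hni := nSign_mul_ncoord_neg hi
      have hnj := nSign_mul_ncoord_neg hj
      rw [nSign_eq_neg_of_CE_eq hCE] at hnj
      rw [hnt] at hni hnj
      have hside : ∀ a ∈ M.CE e, ∀ᶠ θ in 𝓝 θ₀,
          0 < M.ncoord e (γ θ) * M.ncoord e (M.primaryCenter a) →
            M.primaryField φ (γ θ) = φ a := by
        intro a ha
        filter_upwards [(hγ.tendsto θ₀).eventually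
          (eventually_mem_interior_primaryCell hν ha hseg)] with θ hθ h
        exact primaryField_apply φ (hθ h)
      have hsin : ∀ θ, Real.sin (θ - M.edgeAngle ν e) = Real.sin (θ - θ₀) := by
        intro θ
        rw [show θ - M.edgeAngle ν e = (θ - θ₀) + k * (2 * Real.pi) by linarith,
          Real.sin_add_int_mul_two_pi]
      have hxθ : ∀ θ, x e θ = k + (θ - θ₀) / (2 * Real.pi) := by
        intro θ
        simp only [x]
        rw [show θ - M.edgeAngle ν e = k * (2 * Real.pi) + (θ - θ₀) by linarith]
        field_simp
      refine ⟨φ i - (∑ f ∈ (M.EV ν).erase e, c f * (⌊x f θ₀⌋ : ℝ) + c e * k), ?_⟩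
      have hK : ∀ θ, K θ = M.primaryField φ (γ θ) -
          (∑ f ∈ (M.EV ν).erase e, c f * (⌊x f θ⌋ : ℝ) + c e * ⌊x e θ⌋) := by
        intro θ
        simp only [K]
        rw [Finset.sum_erase_add _ _ he]
      have hpi := Real.pi_pos
      rw [← nhdsLT_sup_nhdsGT, eventually_sup]
      constructor
      · filter_upwards [nhdsWithin_le_nhds hrest, nhdsWithin_le_nhds (hside j hj),
          self_mem_nhdsWithin, nhdsWithin_le_nhds (Ioi_mem_nhds (sub_lt_self θ₀ hpi))]
          with θ h1 h2 h3 h4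
        have h3 : θ < θ₀ := h3
        have h4 : θ₀ - Real.pi < θ := h4
        have hs : Real.sin (θ - θ₀) < 0 :=
          Real.sin_neg_of_neg_of_neg_pi_lt (by linarith) (by linarith)
        -- Just before the crossing the staircase is at k - 1, which compensates for the value φ_j =
        -- φ_i - c_e there.
        have hfl : ⌊x e θ⌋ = k - 1 := by
          rw [hxθ, Int.floor_eq_iff]
          push_cast
          have hd1 : -1 ≤ (θ - θ₀) / (2 * Real.pi) := by
            rw [le_div_iff₀ hπ]; linarith
          have hd2 : (θ - θ₀) / (2 * Real.pi) < 0 := div_neg_of_neg_of_pos (by linarith) hπ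
          constructor <;> linarith
        rw [hK, h1, h2, hfl, hce]
        · push_cast; ring
        · simp only [γ]
          rw [ncoord_circle hν, hsin]
          have := mul_pos (mul_pos_of_neg_of_neg hs hnj) hr
          linarith
      · filter_upwards [nhdsWithin_le_nhds hrest, nhdsWithin_le_nhds (hside i hi),
          self_mem_nhdsWithin, nhdsWithin_le_nhds (Iio_mem_nhds (lt_add_of_pos_right θ₀ hpi))]
          with θ h1 h2 h3 h4
        have h3 : θ₀ < θ := h3
        have h4 : θ < θ₀ + Real.pi := h4
        have hs : 0 < Real.sin (θ - θ₀) :=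
          Real.sin_pos_of_pos_of_lt_pi (by linarith) (by linarith)
        have hfl : ⌊x e θ⌋ = k := by
          rw [hxθ, Int.floor_eq_iff]
          have hd1 : (θ - θ₀) / (2 * Real.pi) < 1 := by
            rw [div_lt_one hπ]; linarith
          have hd2 : 0 < (θ - θ₀) / (2 * Real.pi) := div_pos (by linarith) hπ
          constructor <;> linarith
        rw [hK, h1, h2, hfl]
        simp only [γ]
        rw [ncoord_circle hν, hsin]
        have := mul_neg_of_pos_of_neg (mul_pos hs hr) hni
        linarith
    -- Away from the edges the circle stays inside one cell and no floor changes.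
    · push Not at hB
      obtain ⟨i, hi⟩ := exists_mem_interior_primaryCell (M := M) hΩ (hrΩ θ₀) (fun e => by
        by_cases he : ν ∈ M.VE e
        · exact hB e (mem_EV.2 he)
        · exact hrf θ₀ e he)
      refine ⟨φ i - ∑ e ∈ M.EV ν, c e * ⌊x e θ₀⌋, nhdsWithin_le_nhds ?_⟩
      have hfl : ∀ᶠ θ in 𝓝 θ₀, ∀ f ∈ M.EV ν, ⌊x f θ⌋ = ⌊x f θ₀⌋ := by
        rw [Filter.eventually_all_finset]
        intro f hf
        refine ((hx f).tendsto θ₀).eventually (eventually_floor_eq fun l hl => ?_)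
        have hfν := mem_EV.1 hf
        exact hB f hf (openSegment_subset_primaryEdge hfν
          (circle_mem_openSegment hfν hr (hrρ f hfν) ((hxk f θ₀ l).1 hl)))
      filter_upwards [hfl, (hγ.tendsto θ₀).eventually (isOpen_interior.mem_nhds hi)] with θ h1 h2
      simp only [K]
      rw [primaryField_apply φ h2, Finset.sum_congr rfl fun f hf => by rw [h1 f hf]]
  · have h1 : ∀ e, (⌊x e (θ + 2 * Real.pi)⌋ : ℝ) = ⌊x e θ⌋ + 1 := by
      intro e
      have : x e (θ + 2 * Real.pi) = x e θ + 1 := by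
        simp only [x]
        field_simp
        ring
      rw [this, Int.floor_add_one]
      push_cast
      rfl
    simp only [K, γ, circleVec_add_two_pi, h1, mul_add, mul_one, Finset.sum_add_distrib]
    ring

/-! ### From fields to coefficients -/

theorem edgeEquiv_symm_grad [Fintype I] [Fintype E] (φ : M.Phi) (e : E) :
    M.edgeEquiv.symm (M.grad φ) e =
      -1 / M.dualLength e * ∑ i ∈ M.CE e, M.primaryEquiv.symm φ i * M.nSign e i := by
  rw [grad, LinearEquiv.symm_apply_apply]

/-- Finiteness matters as well, since `toReal` sends infinity to 0; with a positive area the factor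
-1/|A_ν| can be cancelled. -/
theorem volume_dualCell_pos (M : StaggeredMesh Ω I N E) (ν : N) :
    0 < (MeasureTheory.volume (M.dualCell ν)).toReal := by
  obtain ⟨n, c, hP, -⟩ := M.dualCell_polygon ν
  refine ENNReal.toReal_pos ?_ hP.isCompact.measure_lt_top.ne
  exact ((isOpen_interior.measure_pos _ ⟨_, M.dualCenter_mem ν⟩).trans_le
    (MeasureTheory.measure_mono interior_subset)).ne'

theorem curl_eq_zero_iff [Fintype N] [Fintype E] (u : M.V) :
    M.curl u = 0 ↔ ∀ ν, ∑ e ∈ M.EV ν,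
      M.edgeEquiv.symm u e * M.dualLength e * M.tSign e ν = 0 := by
  rw [curl, LinearEquiv.map_eq_zero_iff, funext_iff]
  refine forall_congr' fun ν => ?_
  have h := volume_dualCell_pos M ν
  have h' : -1 / (MeasureTheory.volume (M.dualCell ν)).toReal ≠ 0 :=
    div_ne_zero (by norm_num) h.ne'
  simp only [Pi.zero_apply, mul_eq_zero, h', false_or]

end StaggeredMesh

end StaggeredGrid

end

theorem mainTheorem9 {Ω : Set StaggeredGrid.Plane} (hΩ : StaggeredGrid.IsPolygonalDomain Ω)
    (hsc : IsSimplyConnected Ω) {I N E : Type*} [Fintype I] [Fintype N] [Fintype E]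
    (M : StaggeredGrid.StaggeredMesh Ω I N E) (u : M.V) :
    M.curl u = 0 ↔ ∃ φ : M.Phi, u = M.grad φ := by
  rw [StaggeredGrid.StaggeredMesh.curl_eq_zero_iff]
  constructor
  · intro h
    -- The prescribed jumps are w_e = u_e d_e, read off from `h` by unification.
    obtain ⟨φ, hφ⟩ := StaggeredGrid.StaggeredMesh.exists_potential M hΩ hsc _ h
    refine ⟨M.primaryEquiv φ, M.edgeEquiv.symm.injective (funext fun e => ?_)⟩
    rw [StaggeredGrid.StaggeredMesh.edgeEquiv_symm_grad, LinearEquiv.symm_apply_apply, hφ]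
    have := (StaggeredGrid.StaggeredMesh.dualLength_pos M e).ne'
    field_simp
  · rintro ⟨φ, rfl⟩ ν
    rw [← neg_eq_zero, ← Finset.sum_neg_distrib,
      ← StaggeredGrid.StaggeredMesh.sum_jump_eq_zero hΩ M (M.primaryEquiv.symm φ) ν]
    refine Finset.sum_congr rfl fun e _ => ?_
    rw [StaggeredGrid.StaggeredMesh.edgeEquiv_symm_grad]
    have := (StaggeredGrid.StaggeredMesh.dualLength_pos M e).ne'
    field_simp
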